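/- Let $N\ge 2$ be an integer and let $\mu$ be the normalized Haar measure on the unit circle $\mathbb T$. Let $m_0\in L^\infty(\mathbb T)$ be nonzero almost everywhere, and let $h\in L^1(\mathbb T)$, $h\ge 0$ almost everywhere, satisfy $R_{m_0,m_0}h=h$ almost everywhere, where $$(R_{m_0,m_0}f)(z)=\frac1N\sum_{w^N=z}|m_0(w)|^2f(w).$$ Let $\mathfrak A_N$ be the $C^*$-algebra generated by two unitaries $U,V$ subject to $UVU^{-1}=V^N$. A cyclic representation of $\mathfrak A_N$ associated to $h$ consists of a complex Hilbert space $\mathcal H$, a unitary $U$ on $\mathcal H$, a unital $*$-representation $\pi$ of $L^\infty(\mathbb T)$ on $\mathcal H$ with $U\pi(f)=\pi(f(z^N))U$ for all $f\in L^\infty(\mathbb T)$ (the generator $V$ of $\mathfrak A_N$ being represented by $\pi(z)$), and a vector $\varphi\in\mathcal H$ which is cyclic for the represented algebra, i.e. for the $C^*$-algebra $\pi_h(\mathfrak A_N)\subset\mathcal B(\mathcal H)$ generated by $U$ and $\pi(z)$, such that $$U\varphi=\pi(m_0)\varphi,\qquad \langle\varphi,\pi(f)\varphi\rangle=\int_{\mathbb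 T}fh\,d\mu\quad(f\in L^\infty(\mathbb T)).$$ Then a cyclic representation of $\mathfrak A_N$ associated to $h$ exists, and for every such representation the commutant $\pi_h(\mathfrak A_N)'\subset\mathcal B(\mathcal H)$ is abelian: any two bounded operators that commute with $\pi_h(\mathfrak A_N)$ commute with each other. -/

import Mathlib

open MeasureTheory

/-- The unit circle `𝕋` carries its Borel `σ`-algebra. -/
noncomputable instance instMeasurableSpaceCircle : MeasurableSpace Circle := borel Circle

instance instBorelSpaceCircle : BorelSpace Circle := ⟨rfl⟩

namespace WaveletGalerkin

/-- The normalized Haar measure `μ` on `𝕋`. -/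
noncomputable def haar : Measure Circle := Measure.haarMeasure ⊤

instance instIsHaarMeasureHaar : haar.IsHaarMeasure := by
  unfold haar; infer_instance

instance instIsProbabilityMeasureHaar : IsProbabilityMeasure haar := by
  constructor
  have := Measure.haarMeasure_self (K₀ := (⊤ : TopologicalSpace.PositiveCompacts Circle))
  simpa [haar] using this

/-- The map `z ↦ z ^ N` preserves the normalized Haar measure, for `N ≠ 0`. -/
theorem measurePreserving_pow {N : ℕ} (hN : N ≠ 0) :
    MeasurePreserving (fun z : Circle => z ^ N) haar haar := by
  have hs : Function.Surjective (powMonoidHom N : Circle →* Circle) := by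
    intro z
    refine ⟨Circle.exp (Complex.arg z / N), ?_⟩
    have hN' : (N : ℝ) ≠ 0 := by exact_mod_cast hN
    rw [powMonoidHom_apply, ← Circle.exp_nsmul, nsmul_eq_mul, mul_div_cancel₀ _ hN']
    exact Circle.exp_arg z
  exact MonoidHom.measurePreserving (f := (powMonoidHom N : Circle →* Circle))
    (continuous_pow N) hs rfl

/-- The wavelet Galerkin (Ruelle) operator
`(R_{m, m'} f)(z) = (1 / N) ∑_{w ^ N = z} conj (m w) * m' w * f w`.
The sum is over a finite set when `N ≠ 0`. -/
noncomputable def ruelle (N : ℕ) (m m' : Circle → ℂ) (f : Circle → ℂ) (z : Circle) : ℂ :=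
  (1 / (N : ℂ)) * ∑ᶠ w ∈ {w : Circle | w ^ N = z}, star (m w) * m' w * f w

/-- The `*`-algebra of (representatives of) functions in `L^∞(𝕋)`, with pointwise operations. -/
noncomputable def LInf : StarSubalgebra ℂ (Circle → ℂ) where
  carrier := {f | MemLp f ⊤ haar}
  mul_mem' hf hg := hg.mul hf
  one_mem' := memLp_top_const 1
  add_mem' hf hg := hf.add hg
  zero_mem' := MemLp.zero
  algebraMap_mem' c := memLp_top_const c
  star_mem' hf := hf.star

/-- The function `z ↦ f (z ^ N)`, for `f` in `L^∞(𝕋)`. -/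
noncomputable def LInf.dilate (N : ℕ) [NeZero N] (f : LInf) : LInf :=
  ⟨fun z => (f : Circle → ℂ) (z ^ N),
    f.2.comp_measurePreserving (measurePreserving_pow (NeZero.ne N))⟩

/-- The coordinate function `z ↦ z` in `L^∞(𝕋)`. -/
noncomputable def LInf.coord : LInf :=
  ⟨fun z => (z : ℂ), memLp_top_of_bound (Continuous.aestronglyMeasurable (by fun_prop)) 1
    (Filter.Eventually.of_forall fun z => (Circle.norm_coe z).le)⟩

universe u

/-- A representation on the Hilbert space `H` of the algebra generated by two unitaries `U`, `V`
with `U V U⁻¹ = V ^ N`, given by the unitary `U` and a unital `*`-representation `π` of `L^∞(𝕋)`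
with `U π(f) = π(f(z ^ N)) U`; the second unitary is `V = π(z)`. -/
structure Rep (N : ℕ) [NeZero N] (H : Type u) [NormedAddCommGroup H] [InnerProductSpace ℂ H]
    [CompleteSpace H] where
  /-- the unitary `U` -/
  U : H →L[ℂ] H
  /-- `U` is unitary -/
  U_mem : U ∈ unitary (H →L[ℂ] H)
  /-- the representation of `L^∞(𝕋)` -/
  π : LInf →⋆ₐ[ℂ] (H →L[ℂ] H)
  /-- `π(f)` depends only on the almost everywhere class of `f` -/
  π_congr : ∀ f g : LInf, (f : Circle → ℂ) =ᵐ[haar] (g : Circle → ℂ) → π f = π g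
  /-- the covariance relation -/
  covariant : ∀ f : LInf, U * π f = π (LInf.dilate N f) * U

namespace Rep

variable {N : ℕ} [NeZero N] {H : Type u} [NormedAddCommGroup H] [InnerProductSpace ℂ H]
  [CompleteSpace H]

/-- The unitary `V = π(z)`. -/
noncomputable def V (ρ : Rep N H) : H →L[ℂ] H := ρ.π LInf.coord

/-- The image of the algebra in `B(H)`: the `C*`-algebra generated by `U` and `V`. -/
noncomputable def image (ρ : Rep N H) : StarSubalgebra ℂ (H →L[ℂ] H) :=
  (StarAlgebra.adjoin ℂ ({ρ.U, ρ.V} : Set (H →L[ℂ] H))).topologicalClosure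

/-- The commutant in `B(H)` of the image of the algebra. -/
def commutant (ρ : Rep N H) : Set (H →L[ℂ] H) :=
  Set.centralizer (ρ.image : Set (H →L[ℂ] H))

/-- `(ρ, H, φ)` is the cyclic representation associated to the filter `m₀` and to `h`: the vector
`φ` is cyclic, `U φ = π(m₀) φ`, and `⟨φ, π(f) φ⟩ = ∫ f h dμ` for all `f` in `L^∞(𝕋)`. -/
structure IsAssociated (ρ : Rep N H) (m₀ : LInf) (h : Circle → ℝ) (φ : H) : Prop where
  cyclic : Dense {x : H | ∃ A ∈ ρ.image, A φ = x}
  scaling : ρ.U φ = ρ.π m₀ φ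
  moment : ∀ f : LInf,
    inner ℂ φ (ρ.π f φ) = ∫ z, (f : Circle → ℂ) z * (h z : ℂ) ∂haar

end Rep

end WaveletGalerkin

/-! Commutant: let K be the closure of π(L^∞)φ, with projection P. The moment identity makes π(f)φ ↦
f isometric into L²(h dμ), where continuous functions are dense, so φ is already cyclic in K for the
abelian algebra M generated by V. Compressions PSP and PTP of commutant elements commute with M, and
on K anything commuting with an abelian *-algebra that has a cyclic vector commutes with anything
else of that kind (`inner_comm_of_abelian_cyclic`); hence PSPTP = PTPSP. The scaling relation gives
UK ⊆ K, so the subspaces U⁻ⁿK increase; cyclicity makes their union dense, and Eₙ = U⁻ⁿPUⁿ tends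
strongly to 1 (`tendsto_starProjection_conj`). Since S and T commute with U, EₙSEₙTEₙ = U⁻ⁿ(PSPTP)Uⁿ
is symmetric in S and T, and its strong limit is ST.

Existence: the equation Rh = h says that z ↦ z^N carries |m₀|²h dμ to h dμ
(`lintegral_pow_mul_enorm_sq`), so g ↦ m₀·g(z^N) is an isometry J of L²(h dμ). Its minimal unitary
dilation acts on L²(h dμ) ⊕ D ⊕ D ⊕ ⋯, with D = (ran J)^⊥, by (x₀, x₁, x₂, …) ↦ (Jx₀ + x₁, x₂, …),
and f acts on the n-th summand as f(z^(N^n)). The vector φ is the constant 1 in the zeroth summand;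
minimality of the dilation gives cyclicity (`eq_top_of_dilIsometry_comap_le`). -/

namespace WaveletGalerkin

/-! ### The vectors π(f)φ inside L²(h dμ) -/

/-- Continuous functions on the circle, as elements of `L^∞(𝕋)`. -/
noncomputable def LInf.ofContinuous : C(Circle, ℂ) →⋆ₐ[ℂ] LInf where
  toFun g := ⟨g, memLp_top_of_bound g.continuous.aestronglyMeasurable ‖g‖
    (Filter.Eventually.of_forall g.norm_coe_le_norm)⟩
  map_one' := rfl
  map_mul' _ _ := rfl
  map_zero' := rfl
  map_add' _ _ := rfl
  commutes' _ := rfl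
  map_star' _ := rfl

/-- The inclusion of the circle into `ℂ`, as a continuous function. -/
noncomputable def circleCoe : C(Circle, ℂ) := ⟨fun z => (z : ℂ), by fun_prop⟩

theorem adjoin_circleCoe_topologicalClosure :
    (StarAlgebra.adjoin ℂ ({circleCoe} : Set C(Circle, ℂ))).topologicalClosure = ⊤ := by
  apply ContinuousMap.starSubalgebra_topologicalClosure_eq_top_of_separatesPoints
  intro x y hxy
  exact ⟨circleCoe, ⟨circleCoe, StarAlgebra.subset_adjoin ℂ _ rfl, rfl⟩,
    fun h => hxy (Circle.ext h)⟩

/-- The measure on the circle with density `h`. -/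
noncomputable def weighted (h : Circle → ℝ) : Measure Circle :=
  haar.withDensity fun z => ENNReal.ofReal (h z)

theorem isFiniteMeasure_weighted {h : Circle → ℝ} (h_int : Integrable h haar) :
    IsFiniteMeasure (weighted h) :=
  isFiniteMeasure_withDensity_ofReal h_int.2

theorem weighted_absolutelyContinuous (h : Circle → ℝ) : weighted h ≪ haar :=
  withDensity_absolutelyContinuous _ _

theorem integral_weighted {h : Circle → ℝ} (h_int : Integrable h haar)
    (h_nonneg : ∀ᵐ z ∂haar, 0 ≤ h z) {E : Type*} [NormedAddCommGroup E] [NormedSpace ℝ E]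
    (f : Circle → E) :
    ∫ z, f z ∂(weighted h) = ∫ z, h z • f z ∂haar := by
  rw [weighted, integral_withDensity_eq_integral_toReal_smul₀
    h_int.aestronglyMeasurable.aemeasurable.ennreal_ofReal (by simp)]
  refine integral_congr_ae ?_
  filter_upwards [h_nonneg] with z hz
  rw [ENNReal.toReal_ofReal hz]

theorem memLp_weighted {h : Circle → ℝ} (h_int : Integrable h haar) (f : LInf)
    (p : ENNReal) : MemLp (f : Circle → ℂ) p (weighted h) := by
  have := isFiniteMeasure_weighted h_int
  have hf : MemLp (f : Circle → ℂ) ⊤ haar := f.2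
  exact MemLp.mono_exponent ⟨hf.1.mono_ac (weighted_absolutelyContinuous h),
    by
    have := hf.2
    rw [eLpNorm_exponent_top] at this ⊢
    exact (eLpNormEssSup_mono_measure _ (weighted_absolutelyContinuous h)).trans_lt this⟩ le_top

namespace Rep

universe u
variable {N : ℕ} [NeZero N] {H : Type u} [NormedAddCommGroup H] [InnerProductSpace ℂ H]
  [CompleteSpace H]

/-- Stone–Weierstrass, plus automatic continuity of *-homomorphisms between C*-algebras. The latter
is applied on C(𝕋), since `LInf` consists of functions rather than classes and is not normed. -/
theorem π_ofContinuous_mem (ρ : Rep N H) (g : C(Circle, ℂ)) :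
    ρ.π (LInf.ofContinuous g) ∈
      (StarAlgebra.adjoin ℂ ({ρ.V} : Set (H →L[ℂ] H))).topologicalClosure := by
  let Φ : C(Circle, ℂ) →⋆ₐ[ℂ] (H →L[ℂ] H) := ρ.π.comp LInf.ofContinuous
  have hΦ : Continuous Φ :=
    AddMonoidHomClass.continuous_of_bound Φ 1 fun x => by
      simpa only [one_mul] using NonUnitalStarAlgHom.norm_apply_le Φ x
  have hg : g ∈ (StarAlgebra.adjoin ℂ ({circleCoe} : Set C(Circle, ℂ))).topologicalClosure := by
    rw [adjoin_circleCoe_topologicalClosure]; trivial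
  have h1 : Set.MapsTo Φ (StarAlgebra.adjoin ℂ ({circleCoe} : Set C(Circle, ℂ)))
      (StarAlgebra.adjoin ℂ ({ρ.V} : Set (H →L[ℂ] H))) := by
    intro a ha
    have h2 : Φ a ∈ (StarAlgebra.adjoin ℂ {circleCoe}).map Φ := ⟨a, ha, rfl⟩
    rwa [StarAlgHom.map_adjoin, Set.image_singleton] at h2
  exact h1.closure hΦ hg

theorem π_inner (ρ : Rep N H) (f : LInf) (x y : H) :
    inner ℂ (ρ.π f x) y = inner ℂ x (ρ.π (star f) y) := by
  rw [map_star, ContinuousLinearMap.star_eq_adjoint, ContinuousLinearMap.adjoint_inner_right]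

/-- Both sides are ⟨φ, π(|f|²)φ⟩. -/
theorem norm_sq_π_apply (ρ : Rep N H) {h : Circle → ℝ} {φ : H} (h_int : Integrable h haar)
    (h_nonneg : ∀ᵐ z ∂haar, 0 ≤ h z)
    (moment : ∀ f : LInf, inner ℂ φ (ρ.π f φ) = ∫ z, (f : Circle → ℂ) z * (h z : ℂ) ∂haar)
    (f : LInf) :
    ‖ρ.π f φ‖ ^ 2 = ∫ z, ‖(f : Circle → ℂ) z‖ ^ 2 ∂(weighted h) := by
  have h1 : inner ℂ (ρ.π f φ) (ρ.π f φ) =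
      ∫ z, ((star f * f : LInf) : Circle → ℂ) z * (h z : ℂ) ∂haar := by
    rw [π_inner, ← mul_apply_eq_comp, ← map_mul, moment]
  rw [inner_self_eq_norm_sq_to_K] at h1
  rw [integral_weighted h_int h_nonneg]
  apply Complex.ofReal_injective
  rw [← integral_complex_ofReal]
  push_cast
  refine h1.trans (integral_congr_ae (Filter.Eventually.of_forall fun z => ?_))
  change (starRingEnd ℂ ((f : Circle → ℂ) z) * (f : Circle → ℂ) z) * (h z : ℂ) = _
  rw [RCLike.conj_mul]
  simp [mul_comm]

/-- Bridges the gap between the represented C*-algebra, which knows only V, and π, which is given on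
all of L^∞: f is approximated in L²(h dμ) by continuous functions, which are norm limits of
polynomials in V and its adjoint. -/
theorem π_apply_mem_closure (ρ : Rep N H) {h : Circle → ℝ} {φ : H} (h_int : Integrable h haar)
    (h_nonneg : ∀ᵐ z ∂haar, 0 ≤ h z)
    (moment : ∀ f : LInf, inner ℂ φ (ρ.π f φ) = ∫ z, (f : Circle → ℂ) z * (h z : ℂ) ∂haar)
    (f : LInf) :
    ρ.π f φ ∈ closure {x | ∃ A ∈ StarAlgebra.adjoin ℂ ({ρ.V} : Set (H →L[ℂ] H)), A φ = x} := by
  have := isFiniteMeasure_weighted h_int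
  -- The approximants π(g)φ with g continuous lie only in the closure of the orbit, hence the second
  -- closure.
  rw [← closure_closure]
  refine Metric.mem_closure_iff.2 fun ε hε => ?_
  obtain ⟨g, hg, -⟩ := MemLp.exists_boundedContinuous_integral_rpow_sub_le (p := 2) (by norm_num)
    (by simpa using memLp_weighted h_int f 2) (show 0 < ε ^ 2 / 2 by positivity)
  let g' : C(Circle, ℂ) := g.toContinuousMap
  refine ⟨ρ.π (LInf.ofContinuous g') φ, ?_, ?_⟩
  · have hc : Continuous fun A : H →L[ℂ] H => A φ := by fun_prop
    have hm : Set.MapsTo (fun A : H →L[ℂ] H => A φ)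
      (StarAlgebra.adjoin ℂ ({ρ.V} : Set (H →L[ℂ] H)))
      {x | ∃ A ∈ StarAlgebra.adjoin ℂ ({ρ.V} : Set (H →L[ℂ] H)), A φ = x} :=
        fun A hA => ⟨A, hA, rfl⟩
    exact hm.closure hc (π_ofContinuous_mem ρ g')
  · have h1 := ρ.norm_sq_π_apply h_int h_nonneg moment (f - LInf.ofContinuous g')
    rw [dist_eq_norm, ← sub_apply, ← map_sub]
    refine lt_of_pow_lt_pow_left₀ 2 hε.le ?_
    rw [h1]
    refine lt_of_le_of_lt (le_of_eq ?_) (hg.trans_lt (by linarith [pow_pos hε 2]))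
    refine integral_congr_ae (Filter.Eventually.of_forall fun z => ?_)
    simp only [Real.rpow_ofNat]
    rfl

end Rep
-- Operators commuting with an abelian algebra that has a cyclic vector
section Abstract

open Filter Topology

universe u
variable {H : Type u} [NormedAddCommGroup H] [InnerProductSpace ℂ H] [CompleteSpace H]

local notation "⟪" x ", " y "⟫" => inner ℂ x y

theorem inner_star_apply (A : H →L[ℂ] H) (x y : H) : ⟪star A x, y⟫ = ⟪x, A y⟫ := by
  rw [ContinuousLinearMap.star_eq_adjoint, ContinuousLinearMap.adjoint_inner_left]

theorem inner_apply_star (A : H →L[ℂ] H) (x y : H) : ⟪x, star A y⟫ = ⟪A x, y⟫ := by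
  rw [ContinuousLinearMap.star_eq_adjoint, ContinuousLinearMap.adjoint_inner_right]

omit [CompleteSpace H] in
theorem apply_comm_of_commute {A B : H →L[ℂ] H} (h : A * B = B * A) (x : H) :
    A (B x) = B (A x) := DFunLike.congr_fun h x

/-- If `φ` is a vector and `M` is an abelian `*`-algebra of operators, then two operators that
commute with `M` commute with each other on the closure of `M φ`, in the weak sense. -/
theorem inner_comm_of_abelian_cyclic (M : StarSubalgebra ℂ (H →L[ℂ] H))
    (hM : ∀ a ∈ M, ∀ b ∈ M, a * b = b * a) (φ : H) (A B : H →L[ℂ] H)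
    (hA : ∀ m ∈ M, m * A = A * m) (hB : ∀ m ∈ M, m * B = B * m)
    (hAφ : A φ ∈ closure {x | ∃ m ∈ M, m φ = x})
    (hAφ' : star A φ ∈ closure {x | ∃ m ∈ M, m φ = x})
    {x y : H} (hx : x ∈ closure {x | ∃ m ∈ M, m φ = x})
    (hy : y ∈ closure {x | ∃ m ∈ M, m φ = x}) :
    ⟪y, A (B x)⟫ = ⟪y, B (A x)⟫ := by
  have hA' : ∀ m ∈ M, m * star A = star A * m := by
    intro m hm
    have := congrArg star (hA _ (star_mem hm))
    simpa using this.symm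
  obtain ⟨s, hs, hlim⟩ := mem_closure_iff_seq_limit.1 hAφ'
  choose a haM has using hs
  have hlim' : Tendsto (fun n => a n φ) atTop (𝓝 (star A φ)) := by simpa only [has] using hlim
  -- Elements of M are normal, so ‖a*φ‖ = ‖aφ‖ and the adjoints aₙ*φ converge along with aₙφ.
  have hcauchy : CauchySeq fun n => star (a n) φ := by
    have h1 : ∀ n m, dist (star (a n) φ) (star (a m) φ) = dist (a n φ) (a m φ) := by
      intro n m
      have h2 : IsStarNormal (a n - a m) := ⟨hM _ (star_mem (sub_mem (haM n) (haM m))) _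
        (sub_mem (haM n) (haM m))⟩
      rw [dist_eq_norm, dist_eq_norm, ← sub_apply, ← sub_apply, ← star_sub]
      exact ((ContinuousLinearMap.isStarNormal_iff_norm_eq_adjoint).1 h2 φ).symm
    have h3 := hlim'.cauchySeq
    rw [Metric.cauchySeq_iff] at h3 ⊢
    simpa only [h1] using h3
  obtain ⟨ξ, hξ⟩ := cauchySeq_tendsto_of_complete hcauchy
  have hξmem : ξ ∈ closure {x | ∃ m ∈ M, m φ = x} :=
    mem_closure_of_tendsto hξ (Eventually.of_forall fun n => ⟨_, star_mem (haM n), rfl⟩)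
  -- The limit ξ of aₙ*φ pairs with Mφ as Aφ does. Both lie in the closure of Mφ, so ξ = Aφ.
  have hinner : ∀ c ∈ M, ⟪ξ, c φ⟫ = ⟪A φ, c φ⟫ := by
    intro c hc
    have h1 : Tendsto (fun n => ⟪star (a n) φ, c φ⟫) atTop (𝓝 ⟪ξ, c φ⟫) :=
      hξ.inner tendsto_const_nhds
    have h2 : Tendsto (fun n => ⟪star c φ, a n φ⟫) atTop (𝓝 ⟪star c φ, star A φ⟫) :=
      tendsto_const_nhds.inner hlim'
    have h3 : ∀ n, ⟪star (a n) φ, c φ⟫ = ⟪star c φ, a n φ⟫ := by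
      intro n
      rw [inner_star_apply, inner_star_apply, apply_comm_of_commute (hM _ (haM n) _ hc)]
    simp only [h3] at h1
    rw [tendsto_nhds_unique h1 h2, inner_star_apply, apply_comm_of_commute (hA' c hc),
      inner_apply_star]
  have hall : ∀ w ∈ closure {x | ∃ m ∈ M, m φ = x}, ⟪ξ, w⟫ = ⟪A φ, w⟫ := by
    intro w hw
    exact Set.EqOn.closure (f := fun w => ⟪ξ, w⟫) (g := fun w => ⟪A φ, w⟫)
      (by rintro _ ⟨c, hc, rfl⟩; exact hinner c hc) (by fun_prop) (by fun_prop) hw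
  have hξA : ξ = A φ := by
    rw [← sub_eq_zero, ← inner_self_eq_zero (𝕜 := ℂ), inner_sub_right, inner_sub_left,
      inner_sub_left, hall ξ hξmem, hall (A φ) hAφ]
    simp
  rw [hξA] at hξ
  -- A* is moved onto m'φ and replaced by aₙ, which commutes with m', m and B; its adjoint then
  -- reappears on the right and tends to A.
  have key : ∀ m ∈ M, ∀ m' ∈ M, ⟪m' φ, A (B (m φ))⟫ = ⟪m' φ, B (A (m φ))⟫ := by
    intro m hm m' hm'
    have h1 : Tendsto (fun n => ⟪m' (a n φ), B (m φ)⟫) atTop (𝓝 ⟪m' (star A φ), B (m φ)⟫) :=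
      ((m'.continuous.tendsto _).comp hlim').inner tendsto_const_nhds
    have h2 : Tendsto (fun n => ⟪m' φ, B (m (star (a n) φ))⟫) atTop (𝓝 ⟪m' φ, B (m (A φ))⟫) :=
      tendsto_const_nhds.inner (((B * m).continuous.tendsto _).comp hξ)
    have h3 : ∀ n, ⟪m' (a n φ), B (m φ)⟫ = ⟪m' φ, B (m (star (a n) φ))⟫ := by
      intro n
      rw [apply_comm_of_commute (hM _ hm' _ (haM n)),
        apply_comm_of_commute (hM _ hm _ (star_mem (haM n))),
        ← apply_comm_of_commute (hB _ (star_mem (haM n))), inner_apply_star]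
    simp only [h3] at h1
    rw [← inner_star_apply, ← apply_comm_of_commute (hA' m' hm'), tendsto_nhds_unique h1 h2,
      apply_comm_of_commute (hA m hm)]
  refine eqOn_closure₂ (f := fun x y => ⟪y, A (B x)⟫) (g := fun x y => ⟪y, B (A x)⟫)
    (s := {x | ∃ m ∈ M, m φ = x}) (t := {x | ∃ m ∈ M, m φ = x}) ?_ (by fun_prop) (by fun_prop)
    x hx y hy
  rintro _ ⟨m, hm, rfl⟩ _ ⟨m', hm', rfl⟩
  exact key m hm m' hm'

/-- K reduces m: since m* preserves K, the vector m(x − Px) stays orthogonal to K. -/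
theorem starProjection_comm {K : Submodule ℂ H} [K.HasOrthogonalProjection] {m : H →L[ℂ] H}
    (h : ∀ x ∈ K, m x ∈ K) (h' : ∀ x ∈ K, star m x ∈ K) :
    m * K.starProjection = K.starProjection * m := by
  ext x
  refine (Submodule.eq_starProjection_of_mem_of_inner_eq_zero
    (h _ (Submodule.starProjection_apply_mem K x)) fun w hw => ?_).symm
  change ⟪m x - m (K.starProjection x), w⟫ = 0
  rw [← map_sub, ← inner_apply_star, Submodule.starProjection_inner_eq_zero x _ (h' w hw)]

/-- K reduces M, so the compressions still commute with M, and they send φ into the closure of Mφ.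
The weak identity on K becomes an operator identity by testing against Px and Py. -/
theorem compression_comm_of_abelian_cyclic (M : StarSubalgebra ℂ (H →L[ℂ] H))
    (hM : ∀ a ∈ M, ∀ b ∈ M, a * b = b * a) (φ : H) (S T : H →L[ℂ] H)
    (hS : ∀ m ∈ M, m * S = S * m) (hT : ∀ m ∈ M, m * T = T * m)
    (K : Submodule ℂ H) [K.HasOrthogonalProjection]
    (hKM : (K : Set H) = closure {x | ∃ m ∈ M, m φ = x}) :
    K.starProjection * S * K.starProjection * T * K.starProjection =
      K.starProjection * T * K.starProjection * S * K.starProjection := by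
  set P := K.starProjection with hP
  have hPK : ∀ x, P x ∈ K := Submodule.starProjection_apply_mem K
  have hPP : P * P = P := K.isIdempotentElem_starProjection
  have hPP' : ∀ X, P * (P * X) = P * X := fun X => by rw [← mul_assoc, hPP]
  have hPs : star P = P := (isSelfAdjoint_starProjection K)
  have hinv : ∀ m ∈ M, ∀ x ∈ K, m x ∈ K := by
    intro m hm x hx
    rw [← SetLike.mem_coe, hKM] at hx ⊢
    refine Set.MapsTo.closure (f := m) ?_ m.continuous hx
    rintro _ ⟨c, hc, rfl⟩
    exact ⟨m * c, mul_mem hm hc, rfl⟩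
  have hMP : ∀ m ∈ M, m * P = P * m := fun m hm =>
    starProjection_comm (hinv m hm) (hinv _ (star_mem hm))
  have hcomp : ∀ R : H →L[ℂ] H, (∀ m ∈ M, m * R = R * m) →
      ∀ m ∈ M, m * (P * R * P) = P * R * P * m := by
    intro R hR m hm
    rw [← mul_assoc, ← mul_assoc, hMP m hm, mul_assoc P m R, hR m hm, mul_assoc, mul_assoc,
      hMP m hm]
    simp only [mul_assoc]
  have hmem : ∀ z, P z ∈ closure {x | ∃ m ∈ M, m φ = x} := by
    intro z
    rw [← hKM]
    exact hPK z
  have h1 : (P * S * P) * (P * T * P) = (P * T * P) * (P * S * P) := by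
    ext x
    refine ext_inner_left ℂ fun y => ?_
    have h2 := inner_comm_of_abelian_cyclic M hM φ (P * S * P) (P * T * P) (hcomp S hS)
      (hcomp T hT) (hmem _) (by
        rw [star_mul, star_mul, hPs]
        exact hmem _) (hmem x) (hmem y)
    have h3 : ∀ S T : H →L[ℂ] H, ⟪P y, (P * S * P) ((P * T * P) (P x))⟫ =
        ⟪y, ((P * S * P) * (P * T * P)) x⟫ := by
      intro S T
      rw [← inner_apply_star, hPs]
      change ⟪y, (P * ((P * S * P) * ((P * T * P) * P))) x⟫ = _
      simp only [mul_assoc, hPP, hPP']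
    rwa [h3, h3] at h2
  simpa only [mul_assoc, hPP, hPP'] using h1

omit [CompleteSpace H] in
-- Lets strong limits pass through products: ‖Eₙ(zₙ − x)‖ ≤ ‖zₙ − x‖.
theorem tendsto_contraction_apply {E : ℕ → H →L[ℂ] H} (hE : ∀ n x, ‖E n x‖ ≤ ‖x‖)
    (hlim : ∀ x, Tendsto (fun n => E n x) atTop (𝓝 x)) {z : ℕ → H} {x : H}
    (hz : Tendsto z atTop (𝓝 x)) : Tendsto (fun n => E n (z n)) atTop (𝓝 x) := by
  have h1 : Tendsto (fun n => E n (z n - x)) atTop (𝓝 0) := by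
    refine squeeze_zero_norm (fun n => hE n _) ?_
    have := (hz.sub_const x).norm
    simpa using this
  simpa using h1.add (hlim x)

end Abstract
-- The increasing subspaces U⁻ⁿK and the commutant
namespace Rep
open Filter Topology

universe u
variable {N : ℕ} [NeZero N] {H : Type u} [NormedAddCommGroup H] [InnerProductSpace ℂ H]
  [CompleteSpace H]

/-- The closed subspace spanned by the vectors `π(f) φ`. -/
noncomputable def cyclicSubspace (ρ : Rep N H) (φ : H) : Submodule ℂ H :=
  (LinearMap.range ((ContinuousLinearMap.apply ℂ H φ : (H →L[ℂ] H) →ₗ[ℂ] H) ∘ₗ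
    (ρ.π : LInf →ₗ[ℂ] (H →L[ℂ] H)))).topologicalClosure

theorem coe_cyclicSubspace (ρ : Rep N H) (φ : H) :
    (ρ.cyclicSubspace φ : Set H) = closure (Set.range fun f => ρ.π f φ) := rfl

instance (ρ : Rep N H) (φ : H) : CompleteSpace (ρ.cyclicSubspace φ) :=
  (Submodule.isClosed_topologicalClosure _).completeSpace_coe

theorem π_apply_mem_cyclicSubspace (ρ : Rep N H) (φ : H) (f : LInf) :
    ρ.π f φ ∈ ρ.cyclicSubspace φ := by
  rw [← SetLike.mem_coe, coe_cyclicSubspace]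
  exact subset_closure ⟨f, rfl⟩

theorem π_mapsTo_cyclicSubspace (ρ : Rep N H) (φ : H) (f : LInf) {x : H}
    (hx : x ∈ ρ.cyclicSubspace φ) : ρ.π f x ∈ ρ.cyclicSubspace φ := by
  rw [← SetLike.mem_coe, coe_cyclicSubspace] at hx ⊢
  refine Set.MapsTo.closure (f := ρ.π f) ?_ (ρ.π f).continuous hx
  rintro _ ⟨g, rfl⟩
  exact ⟨f * g, by simp [map_mul]⟩

theorem U_π_apply (ρ : Rep N H) (f : LInf) (x : H) :
    ρ.U (ρ.π f x) = ρ.π (LInf.dilate N f) (ρ.U x) :=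
  DFunLike.congr_fun (ρ.covariant f) x

/-- Covariance and scaling give Uπ(g)φ = π(g(z^N)m₀)φ. -/
theorem U_mapsTo_cyclicSubspace (ρ : Rep N H) {φ : H} {m₀ : LInf} (hφ : ρ.U φ = ρ.π m₀ φ)
    {x : H} (hx : x ∈ ρ.cyclicSubspace φ) : ρ.U x ∈ ρ.cyclicSubspace φ := by
  rw [← SetLike.mem_coe, coe_cyclicSubspace] at hx ⊢
  refine Set.MapsTo.closure (f := ρ.U) ?_ ρ.U.continuous hx
  rintro _ ⟨g, rfl⟩
  exact ⟨LInf.dilate N g * m₀, by simp [U_π_apply, hφ]⟩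

theorem U_pow_π_apply (ρ : Rep N H) (n : ℕ) (f : LInf) (x : H) :
    (ρ.U ^ n) (ρ.π f x) = ρ.π ((LInf.dilate N)^[n] f) ((ρ.U ^ n) x) := by
  induction n generalizing f x with
  | zero => rfl
  | succ n ih =>
    rw [pow_succ, mul_apply_eq_comp, U_π_apply, ih, Function.iterate_succ_apply]
    rfl

theorem star_U_U (ρ : Rep N H) (x : H) : star ρ.U (ρ.U x) = x :=
  DFunLike.congr_fun (Unitary.mem_iff.1 ρ.U_mem).1 x

theorem U_star_U (ρ : Rep N H) (x : H) : ρ.U (star ρ.U x) = x :=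
  DFunLike.congr_fun (Unitary.mem_iff.1 ρ.U_mem).2 x

theorem U_pow_add_mem_cyclicSubspace (ρ : Rep N H) {φ : H} {m₀ : LInf}
    (hφ : ρ.U φ = ρ.π m₀ φ) {x : H} {n k : ℕ} (hx : (ρ.U ^ n) x ∈ ρ.cyclicSubspace φ) :
    (ρ.U ^ (n + k)) x ∈ ρ.cyclicSubspace φ := by
  induction k with
  | zero => exact hx
  | succ k ih =>
    rw [← add_assoc, pow_succ', mul_apply_eq_comp]
    exact ρ.U_mapsTo_cyclicSubspace hφ ih

theorem star_U_pow_mul (ρ : Rep N H) (n : ℕ) : star ρ.U ^ n * ρ.U ^ n = 1 := by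
  rw [← star_pow]; exact (Unitary.mem_iff.1 (pow_mem ρ.U_mem n)).1

theorem U_pow_mul_star (ρ : Rep N H) (n : ℕ) : ρ.U ^ n * star ρ.U ^ n = 1 := by
  rw [← star_pow]; exact (Unitary.mem_iff.1 (pow_mem ρ.U_mem n)).2

theorem norm_conj_starProjection_le (ρ : Rep N H) (K : Submodule ℂ H)
    [K.HasOrthogonalProjection] (n : ℕ) (x : H) :
    ‖(star ρ.U ^ n * K.starProjection * ρ.U ^ n) x‖ ≤ ‖x‖ := by
  have h1 := ContinuousLinearMap.norm_map_of_mem_unitary (pow_mem ρ.U_mem n)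
  have h2 := ContinuousLinearMap.norm_map_of_mem_unitary
    (pow_mem (Unitary.star_mem ρ.U_mem) n)
  change ‖(star ρ.U ^ n) (K.starProjection ((ρ.U ^ n) x))‖ ≤ ‖x‖
  rw [h2]
  exact (K.norm_starProjection_apply_le _).trans (h1 x).le

/-- The vectors that some power of `U` maps into the subspace `K`. -/
def reaches (ρ : Rep N H) (K : Submodule ℂ H) : Set H := {x | ∃ n : ℕ, (ρ.U ^ n) x ∈ K}

/-- The union of the U⁻ⁿK is a subspace because they increase. It is stable under π because Uⁿ
intertwines π(f) with π(f(z^(N^n))), and under U* at the cost of one more power of U. -/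
theorem adjoin_mapsTo_reaches (ρ : Rep N H) (φ : H) {A : H →L[ℂ] H} {m₀ : LInf}
    (hφ : ρ.U φ = ρ.π m₀ φ)
    (hA : A ∈ StarAlgebra.adjoin ℂ ({ρ.U, ρ.V} : Set (H →L[ℂ] H))) :
    ∀ x ∈ ρ.reaches (ρ.cyclicSubspace φ), A x ∈ ρ.reaches (ρ.cyclicSubspace φ) := by
  have hmono {x n} (k) := ρ.U_pow_add_mem_cyclicSubspace hφ (x := x) (n := n) (k := k)
  have hπ : ∀ f, ∀ x ∈ ρ.reaches (ρ.cyclicSubspace φ),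
      ρ.π f x ∈ ρ.reaches (ρ.cyclicSubspace φ) := by
    rintro f x ⟨n, hn⟩
    exact ⟨n, by rw [U_pow_π_apply]; exact ρ.π_mapsTo_cyclicSubspace φ _ hn⟩
  have hU : ∀ x ∈ ρ.reaches (ρ.cyclicSubspace φ), ρ.U x ∈ ρ.reaches (ρ.cyclicSubspace φ) := by
    rintro x ⟨n, hn⟩
    refine ⟨n, ?_⟩
    rw [← mul_apply_eq_comp, ← pow_succ]
    exact hmono 1 hn
  have hU' : ∀ x ∈ ρ.reaches (ρ.cyclicSubspace φ),
      star ρ.U x ∈ ρ.reaches (ρ.cyclicSubspace φ) := by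
    rintro x ⟨n, hn⟩
    refine ⟨n + 1, ?_⟩
    rwa [pow_succ, mul_apply_eq_comp, U_star_U]
  -- The adjoint is carried along so that the induction passes through `star`.
  suffices h : (∀ x ∈ ρ.reaches (ρ.cyclicSubspace φ), A x ∈ ρ.reaches (ρ.cyclicSubspace φ)) ∧
      (∀ x ∈ ρ.reaches (ρ.cyclicSubspace φ), star A x ∈ ρ.reaches (ρ.cyclicSubspace φ)) from h.1
  have hadd : ∀ x y, x ∈ ρ.reaches (ρ.cyclicSubspace φ) → y ∈ ρ.reaches (ρ.cyclicSubspace φ) →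
      x + y ∈ ρ.reaches (ρ.cyclicSubspace φ) := by
    rintro x y ⟨n, hn⟩ ⟨k, hk⟩
    refine ⟨n + k, ?_⟩
    rw [map_add]
    exact add_mem (hmono k hn) (add_comm k n ▸ hmono n hk)
  have hsmul : ∀ (c : ℂ) x, x ∈ ρ.reaches (ρ.cyclicSubspace φ) →
      c • x ∈ ρ.reaches (ρ.cyclicSubspace φ) := by
    rintro c x ⟨n, hn⟩
    exact ⟨n, by rw [map_smul]; exact Submodule.smul_mem _ c hn⟩
  induction hA using StarAlgebra.adjoin_induction with
  | mem A hA =>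
    rcases hA with rfl | rfl
    · exact ⟨hU, hU'⟩
    · refine ⟨hπ _, ?_⟩
      rw [V, ← map_star]
      exact hπ _
  | algebraMap c =>
    rw [← algebraMap_star_comm]
    exact ⟨fun x hx => hsmul c x hx, fun x hx => hsmul _ x hx⟩
  | add A B _ _ hA hB =>
    rw [star_add]
    exact ⟨fun x hx => hadd _ _ (hA.1 x hx) (hB.1 x hx),
      fun x hx => hadd _ _ (hA.2 x hx) (hB.2 x hx)⟩
  | mul A B _ _ hA hB =>
    rw [star_mul]
    exact ⟨fun x hx => hA.1 _ (hB.1 x hx), fun x hx => hB.2 _ (hA.2 x hx)⟩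
  | star A _ hA =>
    rw [star_star]
    exact ⟨hA.2, hA.1⟩

theorem IsAssociated.dense_reaches {ρ : Rep N H} {m₀ : LInf} {h : Circle → ℝ} {φ : H}
    (hρ : ρ.IsAssociated m₀ h φ) : Dense (ρ.reaches (ρ.cyclicSubspace φ)) := by
  have hφ : φ ∈ ρ.reaches (ρ.cyclicSubspace φ) :=
    ⟨0, by simpa using ρ.π_apply_mem_cyclicSubspace φ 1⟩
  refine dense_closure.1 (hρ.cyclic.mono ?_)
  rintro _ ⟨A, hA, rfl⟩
  exact Set.MapsTo.closure (f := fun A : H →L[ℂ] H => A φ)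
    (s := StarAlgebra.adjoin ℂ ({ρ.U, ρ.V} : Set (H →L[ℂ] H)))
    (fun B hB => ρ.adjoin_mapsTo_reaches φ hρ.scaling hB φ hφ) (by fun_prop) hA

theorem mem_commutant_comm {ρ : Rep N H} {S : H →L[ℂ] H} (hS : S ∈ ρ.commutant)
    {A : H →L[ℂ] H} (hA : A ∈ StarAlgebra.adjoin ℂ ({ρ.U, ρ.V} : Set (H →L[ℂ] H))) :
    A * S = S * A :=
  Set.mem_centralizer_iff.1 hS A (StarSubalgebra.le_topologicalClosure _ hA)

/-- The n-th operator projects onto U⁻ⁿK, so it eventually fixes each vector of a dense set; uniform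
contractivity does the rest. -/
theorem tendsto_starProjection_conj {ρ : Rep N H} {m₀ : LInf} {h : Circle → ℝ} {φ : H}
    (hρ : ρ.IsAssociated m₀ h φ) (x : H) :
    Tendsto (fun n => (star ρ.U ^ n * (ρ.cyclicSubspace φ).starProjection * ρ.U ^ n) x)
      atTop (𝓝 x) := by
  set K := ρ.cyclicSubspace φ
  set E : ℕ → H →L[ℂ] H := fun n => star ρ.U ^ n * K.starProjection * ρ.U ^ n with hEdef
  have hE : ∀ n x, ‖E n x‖ ≤ ‖x‖ := ρ.norm_conj_starProjection_le K
  refine Metric.tendsto_atTop.2 fun ε hε => ?_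
  obtain ⟨w, ⟨n, hn⟩, hw⟩ := Metric.mem_closure_iff.1 (hρ.dense_reaches x) (ε / 2) (half_pos hε)
  refine ⟨n, fun m hm => ?_⟩
  have hmw : E m w = w := by
    obtain ⟨k, rfl⟩ := Nat.exists_eq_add_of_le hm
    change (star ρ.U ^ (n + k)) (K.starProjection ((ρ.U ^ (n + k)) w)) = w
    rw [Submodule.starProjection_eq_self_iff.2 (ρ.U_pow_add_mem_cyclicSubspace hρ.scaling hn)]
    exact DFunLike.congr_fun (ρ.star_U_pow_mul _) w
  calc dist (E m x) x ≤ dist (E m x) (E m w) + dist (E m w) x := dist_triangle _ _ _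
    _ ≤ dist x w + dist x w := by
        refine add_le_add ?_ (by rw [hmw, dist_comm])
        rw [dist_eq_norm, dist_eq_norm, ← map_sub]
        exact hE m _
    _ < ε := by linarith

theorem IsAssociated.commutant_comm {ρ : Rep N H} {m₀ : LInf} {h : Circle → ℝ} {φ : H}
    (hρ : ρ.IsAssociated m₀ h φ) (h_int : Integrable h haar) (h_nonneg : ∀ᵐ z ∂haar, 0 ≤ h z)
    {S T : H →L[ℂ] H} (hS : S ∈ ρ.commutant) (hT : T ∈ ρ.commutant) : S * T = T * S := by
  have hV : IsStarNormal ρ.V := ⟨by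
    change star ρ.V * ρ.V = ρ.V * star ρ.V
    rw [V, ← map_star, ← map_mul, ← map_mul, mul_comm]⟩
  set M := StarAlgebra.adjoin ℂ ({ρ.V} : Set (H →L[ℂ] H)) with hMdef
  have hM : ∀ a ∈ M, ∀ b ∈ M, a * b = b * a := by
    intro a ha b hb
    have := StarAlgebra.isMulCommutative_adjoin_singleton ℂ ρ.V
    exact congrArg Subtype.val (mul_comm' (⟨a, ha⟩ : StarAlgebra.adjoin ℂ {ρ.V}) ⟨b, hb⟩)
  have hMle : M ≤ StarAlgebra.adjoin ℂ ({ρ.U, ρ.V} : Set (H →L[ℂ] H)) :=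
    StarAlgebra.adjoin_mono (by simp)
  set K := ρ.cyclicSubspace φ with hK
  set P := K.starProjection with hP
  have hMle' : M ≤ ρ.π.range := by
    refine StarAlgebra.adjoin_le ?_
    rintro _ rfl
    exact ⟨LInf.coord, rfl⟩
  have hKM : (K : Set H) = closure {x | ∃ m ∈ M, m φ = x} := by
    rw [hK, coe_cyclicSubspace]
    apply subset_antisymm
    · refine closure_minimal ?_ isClosed_closure
      rintro _ ⟨f, rfl⟩
      exact ρ.π_apply_mem_closure h_int h_nonneg hρ.moment f
    · refine closure_mono ?_
      rintro _ ⟨m, hm, rfl⟩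
      obtain ⟨f, rfl⟩ := hMle' hm
      exact ⟨f, rfl⟩
  have hcomp := compression_comm_of_abelian_cyclic M hM φ S T
    (fun m hm => mem_commutant_comm hS (hMle hm))
    (fun m hm => mem_commutant_comm hT (hMle hm)) K hKM
  have hUmem : ρ.U ∈ StarAlgebra.adjoin ℂ ({ρ.U, ρ.V} : Set (H →L[ℂ] H)) :=
    StarAlgebra.subset_adjoin ℂ _ (by simp)
  let E : ℕ → H →L[ℂ] H := fun n => star ρ.U ^ n * P * ρ.U ^ n
  have hlim : ∀ x, Tendsto (fun n => E n x) atTop (𝓝 x) := tendsto_starProjection_conj hρ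
  have hE : ∀ n x, ‖E n x‖ ≤ ‖x‖ := ρ.norm_conj_starProjection_le K
  -- The inner factors UⁿSU⁻ⁿ and UⁿTU⁻ⁿ collapse to S and T.
  have hEE : ∀ (n : ℕ) (S T : H →L[ℂ] H), S ∈ ρ.commutant → T ∈ ρ.commutant →
      E n * S * E n * T * E n = star ρ.U ^ n * (P * S * P * T * P) * ρ.U ^ n := by
    intro n S T hS hT
    have c : ∀ R ∈ ρ.commutant, ρ.U ^ n * R * star ρ.U ^ n = R := by
      intro R hR
      rw [mem_commutant_comm hR (pow_mem hUmem n), mul_assoc, ρ.U_pow_mul_star, mul_one]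
    calc E n * S * E n * T * E n = star ρ.U ^ n * (P * (ρ.U ^ n * S * star ρ.U ^ n) * P *
          (ρ.U ^ n * T * star ρ.U ^ n) * P) * ρ.U ^ n := by simp only [E, mul_assoc]
      _ = _ := by rw [c S hS, c T hT]
  have hstrong : ∀ (S T : H →L[ℂ] H) (x : H),
      Tendsto (fun n => (E n * S * E n * T * E n) x) atTop (𝓝 (S (T x))) := by
    intro S T x
    exact tendsto_contraction_apply hE hlim ((S.continuous.tendsto _).comp
      (tendsto_contraction_apply hE hlim ((T.continuous.tendsto _).comp (hlim x))))
  have hswap : ∀ n, E n * S * E n * T * E n = E n * T * E n * S * E n := by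
    intro n
    rw [hEE n S T hS hT, hcomp, hEE n T S hT hS]
  ext x
  have h1 := hstrong S T x
  simp only [hswap] at h1
  exact tendsto_nhds_unique h1 (hstrong T S x)

end Rep
-- Averages over N-th roots of unity
section Averaging

variable {N : ℕ} [NeZero N]

noncomputable instance : Fintype (rootsOfUnity N Circle) :=
  have := Finite.of_equiv _ (rootsOfUnityCircleEquiv N).symm.toEquiv
  Fintype.ofFinite _

theorem card_rootsOfUnity_circle : Fintype.card (rootsOfUnity N Circle) = N := by
  rw [← Nat.card_eq_fintype_card, Nat.card_congr (rootsOfUnityCircleEquiv N).toEquiv,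
    Complex.card_rootsOfUnity N]

/-- The fibre of z ↦ z^N through z is a coset of the roots of unity, so the index set no longer
depends on z and the sum can be integrated termwise. -/
theorem finsum_mem_pow_eq {M : Type*} [AddCommMonoid M] (f : Circle → M) (z : Circle) :
    ∑ᶠ w ∈ {w : Circle | w ^ N = z ^ N}, f w =
      ∑ ζ : rootsOfUnity N Circle, f (((ζ : Circleˣ) : Circle) * z) := by
  have hrange : {w : Circle | w ^ N = z ^ N} =
      Set.range fun ζ : rootsOfUnity N Circle => ((ζ : Circleˣ) : Circle) * z := by
    ext w
    constructor
    · intro hw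
      have hw' : (w * z⁻¹) ^ N = 1 := by
        rw [mul_pow, show w ^ N = z ^ N from hw, ← mul_pow, mul_inv_cancel, one_pow]
      exact ⟨rootsOfUnity.mkOfPowEq _ hw', by simp⟩
    · rintro ⟨ζ, rfl⟩
      have : (((ζ : Circleˣ) : Circle)) ^ N = 1 := by
        have := (mem_rootsOfUnity N _).1 ζ.2
        exact_mod_cast congrArg Units.val this
      simp [mul_pow, this]
  rw [hrange, finsum_mem_range, finsum_eq_sum_of_fintype]
  intro a b hab
  exact Subtype.ext (Units.ext (mul_right_cancel hab))

/-- If `H(z ^ N)` is the average of `F` over the translates of `z` by the `N`-th roots of unity,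
then `F dμ` is carried to `H dμ` by `z ↦ z ^ N`. -/
theorem lintegral_pow_mul_eq {F H : Circle → ENNReal} (hF : AEMeasurable F haar)
    (hH : AEMeasurable H haar)
    (hav : ∀ᵐ z ∂haar, H (z ^ N) =
      (N : ENNReal)⁻¹ * ∑ ζ : rootsOfUnity N Circle, F (((ζ : Circleˣ) : Circle) * z))
    {g : Circle → ENNReal} (hg : Measurable g) :
    ∫⁻ z, g (z ^ N) * F z ∂haar = ∫⁻ z, g z * H z ∂haar := by
  have hσ := measurePreserving_pow (NeZero.ne N)
  have hgN : Measurable fun z : Circle => g (z ^ N) := hg.comp hσ.measurable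
  have hterm : ∀ ζ : rootsOfUnity N Circle,
      (fun z => g (z ^ N) * F (((ζ : Circleˣ) : Circle) * z)) =
      fun z => (fun w => g (w ^ N) * F w) (((ζ : Circleˣ) : Circle) * z) := by
    intro ζ
    have : (((ζ : Circleˣ) : Circle)) ^ N = 1 := by
      have := (mem_rootsOfUnity N _).1 ζ.2
      exact_mod_cast congrArg Units.val this
    ext z
    simp [mul_pow, this]
  -- The integral is written as an average of N copies and the copy of index ζ is rotated by ζ,
  -- which leaves g(z^N) unchanged; the average of F then appears.
  calc ∫⁻ z, g (z ^ N) * F z ∂haar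
      = (N : ENNReal)⁻¹ * ∑ ζ : rootsOfUnity N Circle, ∫⁻ z, g (z ^ N) * F z ∂haar := by
        rw [Finset.sum_const, Finset.card_univ, card_rootsOfUnity_circle, nsmul_eq_mul, ← mul_assoc,
          ENNReal.inv_mul_cancel (by exact_mod_cast NeZero.ne N) (ENNReal.natCast_ne_top N),
          one_mul]
    _ = (N : ENNReal)⁻¹ * ∑ ζ : rootsOfUnity N Circle,
          ∫⁻ z, g (z ^ N) * F (((ζ : Circleˣ) : Circle) * z) ∂haar := by
        congr 1
        refine Finset.sum_congr rfl fun ζ _ => ?_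
        rw [hterm ζ, lintegral_mul_left_eq_self (μ := haar) (fun w => g (w ^ N) * F w)]
    _ = ∫⁻ z, g (z ^ N) * H (z ^ N) ∂haar := by
        have hF' : ∀ ζ : rootsOfUnity N Circle,
            AEMeasurable (fun z => F (((ζ : Circleˣ) : Circle) * z)) haar := fun ζ =>
          hF.comp_quasiMeasurePreserving
            (measurePreserving_mul_left haar ((ζ : Circleˣ) : Circle)).quasiMeasurePreserving
        have hm : ∀ ζ : rootsOfUnity N Circle,
            AEMeasurable (fun z => g (z ^ N) * F (((ζ : Circleˣ) : Circle) * z)) haar := fun ζ =>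
          hgN.aemeasurable.mul (hF' ζ)
        rw [← lintegral_finsetSum' _ fun ζ _ => hm ζ,
          ← lintegral_const_mul'' _ (Finset.aemeasurable_fun_sum _
            fun ζ _ => hm ζ)]
        refine lintegral_congr_ae ?_
        filter_upwards [hav] with z hz
        rw [hz, ← Finset.mul_sum, mul_left_comm]
    _ = ∫⁻ z, g z * H z ∂haar := by
        rw [← lintegral_map' (f := fun z => g z * H z) (by
          rw [hσ.map_eq]; exact hg.aemeasurable.mul hH)
          hσ.measurable.aemeasurable, hσ.map_eq]

theorem ruelle_pow (m : Circle → ℂ) (f : Circle → ℝ) (z : Circle) :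
    ruelle N m m (fun z => (f z : ℂ)) (z ^ N) = ((N : ℝ)⁻¹ * ∑ ζ : rootsOfUnity N Circle,
      ‖m (((ζ : Circleˣ) : Circle) * z)‖ ^ 2 * f (((ζ : Circleˣ) : Circle) * z) : ℝ) := by
  rw [ruelle, finsum_mem_pow_eq, one_div]
  push_cast
  congr 1
  refine Finset.sum_congr rfl fun ζ _ => ?_
  exact congrArg (· * _) (Complex.conj_mul' _)

theorem ofReal_eq_average_of_ruelle_eq {m : Circle → ℂ} {h : Circle → ℝ} {z : Circle}
    (hz : ruelle N m m (fun z => (h z : ℂ)) (z ^ N) = h (z ^ N))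
    (hz' : ∀ ζ : rootsOfUnity N Circle, 0 ≤ h (((ζ : Circleˣ) : Circle) * z)) :
    ENNReal.ofReal (h (z ^ N)) = (N : ENNReal)⁻¹ *
      ∑ ζ : rootsOfUnity N Circle, ENNReal.ofReal
        (‖m (((ζ : Circleˣ) : Circle) * z)‖ ^ 2 * h (((ζ : Circleˣ) : Circle) * z)) := by
  rw [ruelle_pow] at hz
  rw [← Complex.ofReal_injective hz, ENNReal.ofReal_mul (by positivity),
    ENNReal.ofReal_sum_of_nonneg fun ζ _ => mul_nonneg (sq_nonneg _) (hz' ζ),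
    ENNReal.ofReal_inv_of_pos (by exact_mod_cast NeZero.pos N), ENNReal.ofReal_natCast]

/-- The null sets are harmless: z ↦ z^N and the finitely many rotations all preserve Haar measure.
-/
theorem ofReal_pow_eq_average {m : Circle → ℂ} {h : Circle → ℝ}
    (h_nonneg : ∀ᵐ z ∂haar, 0 ≤ h z)
    (h_fix : ruelle N m m (fun z => (h z : ℂ)) =ᵐ[haar] fun z => (h z : ℂ)) :
    ∀ᵐ z ∂haar, ENNReal.ofReal (h (z ^ N)) = (N : ENNReal)⁻¹ *
      ∑ ζ : rootsOfUnity N Circle, ENNReal.ofReal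
        (‖m (((ζ : Circleˣ) : Circle) * z)‖ ^ 2 * h (((ζ : Circleˣ) : Circle) * z)) := by
  have hσ := (measurePreserving_pow (NeZero.ne N)).quasiMeasurePreserving
  have h1 := hσ.tendsto_ae.eventually
      (p := fun z => ruelle N m m (fun z => (h z : ℂ)) z = h z) h_fix
  have h2 : ∀ᵐ z ∂haar, ∀ ζ : rootsOfUnity N Circle, 0 ≤ h (((ζ : Circleˣ) : Circle) * z) :=
    ae_all_iff.2 fun ζ => (measurePreserving_mul_left haar
      ((ζ : Circleˣ) : Circle)).quasiMeasurePreserving.tendsto_ae.eventually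
        (p := fun z => 0 ≤ h z) h_nonneg
  exact (h1.and h2).mono fun z hz => ofReal_eq_average_of_ruelle_eq hz.1 hz.2

theorem lintegral_pow_mul_enorm_sq {m₀ : LInf} {h : Circle → ℝ}
    (h_int : Integrable h haar) (h_nonneg : ∀ᵐ z ∂haar, 0 ≤ h z)
    (h_fix : ruelle N m₀ m₀ (fun z => (h z : ℂ)) =ᵐ[haar] fun z => (h z : ℂ))
    {g : Circle → ENNReal} (hg : Measurable g) :
    ∫⁻ z, g (z ^ N) * ‖(m₀ : Circle → ℂ) z‖ₑ ^ 2 ∂(weighted h) = ∫⁻ z, g z ∂(weighted h) := by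
  have hH : AEMeasurable (fun z => ENNReal.ofReal (h z)) haar :=
    h_int.aestronglyMeasurable.aemeasurable.ennreal_ofReal
  have hm : MemLp (m₀ : Circle → ℂ) ⊤ haar := m₀.2
  have hF : AEMeasurable (fun z => ENNReal.ofReal (‖(m₀ : Circle → ℂ) z‖ ^ 2 * h z)) haar :=
    ((hm.1.norm.aemeasurable.pow_const 2).mul
      h_int.aestronglyMeasurable.aemeasurable).ennreal_ofReal
  have hσ := measurePreserving_pow (NeZero.ne N)
  rw [weighted, lintegral_withDensity_eq_lintegral_mul₀' hH,
    lintegral_withDensity_eq_lintegral_mul₀' hH]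
  · have := lintegral_pow_mul_eq (N := N) hF hH (ofReal_pow_eq_average h_nonneg h_fix) hg
    simp only [Pi.mul_apply]
    refine Eq.trans ?_ (this.trans ?_)
    · refine lintegral_congr fun z => ?_
      rw [ENNReal.ofReal_mul (by positivity), ENNReal.ofReal_pow (norm_nonneg _), ofReal_norm]
      ring
    · simp only [mul_comm]
  · exact hg.aemeasurable
  · exact ((hg.comp hσ.measurable).aemeasurable.mul (hm.1.enorm.pow_const 2)).mono_ac
      (withDensity_absolutelyContinuous _ _)

end Averaging
-- Multiplication operators and the filter isometry on L²(h dμ)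
section Multiplication

variable {h : Circle → ℝ} (h_int : Integrable h haar)

/-- The essential supremum norm of `f`. -/
noncomputable def LInf.supNorm (f : LInf) : ℝ := (eLpNorm (f : Circle → ℂ) ⊤ haar).toReal

theorem LInf.norm_le_supNorm (f : LInf) : ∀ᵐ z ∂haar, ‖(f : Circle → ℂ) z‖ ≤ LInf.supNorm f := by
  have hf : MemLp (f : Circle → ℂ) ⊤ haar := f.2
  filter_upwards [ae_le_eLpNormEssSup (f := (f : Circle → ℂ)) (μ := haar)] with z hz
  rw [← eLpNorm_exponent_top] at hz
  rw [← toReal_enorm]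
  exact ENNReal.toReal_mono hf.2.ne hz

theorem LInf.supNorm_nonneg (f : LInf) : 0 ≤ LInf.supNorm f := ENNReal.toReal_nonneg

theorem LInf.supNorm_dilate {N : ℕ} [NeZero N] (f : LInf) :
    LInf.supNorm (LInf.dilate N f) = LInf.supNorm f := by
  have hf : MemLp (f : Circle → ℂ) ⊤ haar := f.2
  exact congrArg ENNReal.toReal
    (eLpNorm_comp_measurePreserving hf.1 (measurePreserving_pow (NeZero.ne N)))

include h_int in
theorem memLp_mul (f : LInf) (g : Lp ℂ 2 (weighted h)) :
    MemLp (fun z => (f : Circle → ℂ) z * g z) 2 (weighted h) :=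
  (Lp.memLp g).mul' (memLp_weighted h_int f ⊤)

/-- Multiplication by `f` on `L²(h dμ)`. -/
noncomputable def mulOp (f : LInf) : Lp ℂ 2 (weighted h) →L[ℂ] Lp ℂ 2 (weighted h) :=
  LinearMap.mkContinuous
    { toFun := fun g => (memLp_mul h_int f g).toLp
      map_add' := fun g g' => by
        rw [← MemLp.toLp_add]
        refine MemLp.toLp_congr _ _ ?_
        filter_upwards [Lp.coeFn_add g g'] with z hz
        simp only [Pi.add_apply] at hz ⊢
        rw [hz, mul_add]
      map_smul' := fun c g => by
        rw [← MemLp.toLp_const_smul]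
        refine MemLp.toLp_congr _ _ ?_
        filter_upwards [Lp.coeFn_smul c g] with z hz
        rw [RingHom.id_apply, hz, Pi.smul_apply, Pi.smul_apply]
        exact mul_left_comm _ _ _ }
    (LInf.supNorm f) fun g => by
      refine Lp.norm_le_mul_norm_of_ae_le_mul ?_
      filter_upwards [(memLp_mul h_int f g).coeFn_toLp,
        weighted_absolutelyContinuous h (LInf.norm_le_supNorm f)] with z hz hz'
      change ‖((memLp_mul h_int f g).toLp) z‖ ≤ _
      rw [hz, norm_mul]
      gcongr

theorem coeFn_mulOp (f : LInf) (g : Lp ℂ 2 (weighted h)) :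
    mulOp h_int f g =ᵐ[weighted h] fun z => (f : Circle → ℂ) z * g z :=
  (memLp_mul h_int f g).coeFn_toLp

theorem norm_mulOp_le (f : LInf) : ‖mulOp h_int f‖ ≤ LInf.supNorm f :=
  LinearMap.mkContinuous_norm_le _ (LInf.supNorm_nonneg f) _

theorem mulOp_congr {f f' : LInf} (hff' : (f : Circle → ℂ) =ᵐ[haar] (f' : Circle → ℂ)) :
    mulOp h_int f = mulOp h_int f' := by
  ext1 g
  refine Lp.ext ?_
  filter_upwards [coeFn_mulOp h_int f g, coeFn_mulOp h_int f' g,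
    weighted_absolutelyContinuous h hff'] with z h1 h2 h3
  rw [h1, h2, h3]

/-- The representation of `L^∞(𝕋)` on `L²(h dμ)` by multiplication. -/
noncomputable def mulRep : LInf →⋆ₐ[ℂ] (Lp ℂ 2 (weighted h) →L[ℂ] Lp ℂ 2 (weighted h)) where
  toFun := mulOp h_int
  map_one' := by
    ext1 g
    refine Lp.ext ?_
    filter_upwards [coeFn_mulOp h_int 1 g] with z h1
    rw [h1]
    exact one_mul _
  map_mul' f f' := by
    ext1 g
    refine Lp.ext ?_
    filter_upwards [coeFn_mulOp h_int (f * f') g, coeFn_mulOp h_int f (mulOp h_int f' g),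
      coeFn_mulOp h_int f' g] with z h1 h2 h3
    rw [h1, mul_apply_eq_comp, h2, h3]
    exact mul_assoc _ _ _
  map_zero' := by
    ext1 g
    refine Lp.ext ?_
    filter_upwards [coeFn_mulOp h_int 0 g, Lp.coeFn_zero ℂ 2 (weighted h)] with z h1 h2
    rw [h1, zero_apply, h2]
    exact zero_mul _
  map_add' f f' := by
    ext1 g
    refine Lp.ext ?_
    filter_upwards [coeFn_mulOp h_int (f + f') g, coeFn_mulOp h_int f g,
      coeFn_mulOp h_int f' g, Lp.coeFn_add (mulOp h_int f g) (mulOp h_int f' g)] with z h1 h2 h3 h4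
    rw [h1, add_apply, h4, Pi.add_apply, h2, h3]
    exact add_mul _ _ _
  commutes' c := by
    ext1 g
    refine Lp.ext ?_
    filter_upwards [coeFn_mulOp h_int (algebraMap ℂ LInf c) g, Lp.coeFn_smul c g] with z h1 h2
    rw [h1]
    exact h2.symm
  map_star' f := by
    refine (ContinuousLinearMap.eq_adjoint_iff _ _).2 fun x y => ?_
    rw [L2.inner_def, L2.inner_def]
    refine integral_congr_ae ?_
    filter_upwards [coeFn_mulOp h_int (star f) x, coeFn_mulOp h_int f y] with z h1 h2
    rw [h1, h2, RCLike.inner_apply, RCLike.inner_apply, map_mul]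
    change y z * (starRingEnd ℂ (starRingEnd ℂ ((f : Circle → ℂ) z)) * _) = _
    rw [RCLike.conj_conj]
    ring

/-- If s is null for h dμ, then |m₀|² integrates to zero over its preimage, which is therefore null
because m₀ ≠ 0 almost everywhere. This makes g(z^N) well defined on classes. -/
theorem quasiMeasurePreserving_pow_weighted {N : ℕ} [NeZero N] {m₀ : LInf}
    (hm₀ : ∀ᵐ z ∂haar, (m₀ : Circle → ℂ) z ≠ 0)
    (h_int : Integrable h haar) (h_nonneg : ∀ᵐ z ∂haar, 0 ≤ h z)
    (h_fix : ruelle N m₀ m₀ (fun z => (h z : ℂ)) =ᵐ[haar] fun z => (h z : ℂ)) :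
    Measure.QuasiMeasurePreserving (fun z : Circle => z ^ N) (weighted h) (weighted h) := by
  have hσ := (measurePreserving_pow (NeZero.ne N)).measurable
  refine ⟨hσ, Measure.AbsolutelyContinuous.mk fun s hs hs0 => ?_⟩
  have h1 := lintegral_pow_mul_enorm_sq h_int h_nonneg h_fix
    (measurable_const.indicator hs : Measurable (s.indicator fun _ => (1 : ENNReal)))
  rw [lintegral_indicator_const hs, hs0, mul_zero, lintegral_eq_zero_iff'] at h1
  · rw [Measure.map_apply hσ hs, measure_eq_zero_iff_ae_notMem]
    filter_upwards [h1, weighted_absolutelyContinuous h hm₀] with z hz hz' hzs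
    rw [Pi.zero_apply, Set.indicator_of_mem (show z ^ N ∈ s from hzs), one_mul] at hz
    simp [hz'] at hz
  · exact ((measurable_const.indicator hs).comp hσ).aemeasurable.mul
      ((memLp_weighted h_int m₀ 2).1.enorm.pow_const 2)

section Isometry

variable {N : ℕ} [NeZero N] {m₀ : LInf} (hm₀ : ∀ᵐ z ∂haar, (m₀ : Circle → ℂ) z ≠ 0)
  (h_nonneg : ∀ᵐ z ∂haar, 0 ≤ h z)
  (h_fix : ruelle N m₀ m₀ (fun z => (h z : ℂ)) =ᵐ[haar] fun z => (h z : ℂ))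

include h_int h_nonneg h_fix in
theorem eLpNorm_mul_comp_pow (g : Lp ℂ 2 (weighted h)) :
    eLpNorm (fun z => (m₀ : Circle → ℂ) z * g (z ^ N)) 2 (weighted h) =
      eLpNorm g 2 (weighted h) := by
  rw [eLpNorm_eq_lintegral_rpow_enorm_toReal (by norm_num) (by norm_num),
    eLpNorm_eq_lintegral_rpow_enorm_toReal (by norm_num) (by norm_num)]
  congr 1
  simp only [ENNReal.toReal_ofNat, ENNReal.rpow_ofNat]
  rw [← lintegral_pow_mul_enorm_sq h_int h_nonneg h_fix
    ((Lp.stronglyMeasurable g).enorm.pow_const 2)]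
  refine lintegral_congr fun z => ?_
  rw [enorm_mul, mul_pow, mul_comm]

include h_int hm₀ h_nonneg h_fix in
theorem memLp_mul_comp_pow (g : Lp ℂ 2 (weighted h)) :
    MemLp (fun z => (m₀ : Circle → ℂ) z * g (z ^ N)) 2 (weighted h) := by
  refine ⟨(memLp_weighted h_int m₀ 2).1.mul
    ((Lp.aestronglyMeasurable g).comp_quasiMeasurePreserving
    (quasiMeasurePreserving_pow_weighted hm₀ h_int h_nonneg h_fix)), ?_⟩
  rw [eLpNorm_mul_comp_pow h_int h_nonneg h_fix]
  exact Lp.eLpNorm_lt_top g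

/-- The isometry `g ↦ m₀ · g(z ^ N)` of `L²(h dμ)`. -/
noncomputable def filterIsometry : Lp ℂ 2 (weighted h) →ₗᵢ[ℂ] Lp ℂ 2 (weighted h) where
  toFun g := (memLp_mul_comp_pow h_int hm₀ h_nonneg h_fix g).toLp
  map_add' g g' := by
    rw [← MemLp.toLp_add]
    refine MemLp.toLp_congr _ _ ?_
    filter_upwards [(quasiMeasurePreserving_pow_weighted hm₀ h_int h_nonneg h_fix).ae_eq_comp
      (Lp.coeFn_add g g')] with z hz
    simp only [Function.comp_apply, Pi.add_apply] at hz
    rw [hz, Pi.add_apply, mul_add]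
  map_smul' c g := by
    rw [← MemLp.toLp_const_smul]
    refine MemLp.toLp_congr _ _ ?_
    filter_upwards [(quasiMeasurePreserving_pow_weighted hm₀ h_int h_nonneg h_fix).ae_eq_comp
      (Lp.coeFn_smul c g)] with z hz
    simp only [Function.comp_apply, Pi.smul_apply] at hz
    rw [RingHom.id_apply, hz, Pi.smul_apply]
    exact mul_left_comm _ _ _
  norm_map' g := by
    change ‖(memLp_mul_comp_pow h_int hm₀ h_nonneg h_fix g).toLp‖ = _
    rw [Lp.norm_toLp, eLpNorm_mul_comp_pow h_int h_nonneg h_fix, Lp.norm_def]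

theorem coeFn_filterIsometry (g : Lp ℂ 2 (weighted h)) :
    filterIsometry h_int hm₀ h_nonneg h_fix g =ᵐ[weighted h]
      fun z => (m₀ : Circle → ℂ) z * g (z ^ N) :=
  (memLp_mul_comp_pow h_int hm₀ h_nonneg h_fix g).coeFn_toLp

theorem filterIsometry_mulOp (f : LInf) (g : Lp ℂ 2 (weighted h)) :
    filterIsometry h_int hm₀ h_nonneg h_fix (mulOp h_int f g) =
      mulOp h_int (LInf.dilate N f) (filterIsometry h_int hm₀ h_nonneg h_fix g) := by
  refine Lp.ext ?_
  filter_upwards [coeFn_filterIsometry h_int hm₀ h_nonneg h_fix (mulOp h_int f g),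
    coeFn_mulOp h_int (LInf.dilate N f) (filterIsometry h_int hm₀ h_nonneg h_fix g),
    coeFn_filterIsometry h_int hm₀ h_nonneg h_fix g,
    (quasiMeasurePreserving_pow_weighted hm₀ h_int h_nonneg h_fix).ae_eq_comp
      (coeFn_mulOp h_int f g)] with z h1 h2 h3 h4
  simp only [Function.comp_apply] at h4
  rw [h1, h2, h3, h4]
  exact mul_left_comm _ _ _

end Isometry
end Multiplication
-- The minimal unitary dilation of an isometry
section Dilation

open Submodule

variable {K : Type} [NormedAddCommGroup K] [InnerProductSpace ℂ K]

/-- The defect space of an isometry, i.e. the orthogonal complement of its range. -/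
noncomputable def defect (S : K →ₗᵢ[ℂ] K) : Submodule ℂ K := (LinearMap.range S.toLinearMap)ᗮ

/-- The summands of the space of the minimal unitary dilation of an isometry: the whole space,
followed by copies of the defect space. -/
noncomputable def dilSummand (S : K →ₗᵢ[ℂ] K) : ℕ → Submodule ℂ K
  | 0 => ⊤
  | _ + 1 => defect S

theorem isClosed_dilSummand (S : K →ₗᵢ[ℂ] K) : ∀ n, IsClosed (dilSummand S n : Set K)
  | 0 => isClosed_univ
  | _ + 1 => Submodule.isClosed_orthogonal _

instance [CompleteSpace K] (S : K →ₗᵢ[ℂ] K) (n : ℕ) : CompleteSpace (dilSummand S n) :=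
  (isClosed_dilSummand S n).completeSpace_coe

/-- The space of the minimal unitary dilation of an isometry. -/
abbrev DilSpace (S : K →ₗᵢ[ℂ] K) : Type := lp (fun n => dilSummand S n) 2

variable {S : K →ₗᵢ[ℂ] K}

theorem DilSpace.hasSum_norm_sq (x : DilSpace S) :
    HasSum (fun n => ‖(x n : K)‖ ^ 2) (‖x‖ ^ 2) := by
  have := lp.hasSum_norm (p := 2) (by norm_num) x
  simpa using this

theorem memℓp_dilSummand {x : ∀ n, dilSummand S n} (hx : Summable fun n => ‖(x n : K)‖ ^ 2) :
    Memℓp x 2 := by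
  refine memℓp_gen ?_
  simpa using hx

theorem DilSpace.ext {x y : DilSpace S} (hxy : ∀ n, (x n : K) = y n) : x = y :=
  lp.ext (funext fun n => Subtype.ext (hxy n))

section Diagonal

variable (A : ℕ → K →L[ℂ] K) (hA : ∀ n, ∀ x ∈ dilSummand S n, A n x ∈ dilSummand S n)
  {C : ℝ} (hC : ∀ n, ‖A n‖ ≤ C)

include hC in
theorem norm_sq_diag_le (x : DilSpace S) (n : ℕ) :
    ‖A n (x n : K)‖ ^ 2 ≤ C ^ 2 * ‖(x n : K)‖ ^ 2 := by
  rw [← mul_pow]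
  exact pow_le_pow_left₀ (norm_nonneg _) ((A n).le_of_opNorm_le (hC n) _) 2

/-- The componentwise action of a bounded sequence of operators that preserve the summands, as a
linear map. -/
noncomputable def diagLinear : DilSpace S →ₗ[ℂ] DilSpace S where
  toFun x := ⟨fun n => ⟨A n (x n : K), hA n _ (x n).2⟩, memℓp_dilSummand
    (Summable.of_nonneg_of_le (fun _ => sq_nonneg _) (norm_sq_diag_le A hC x)
      ((DilSpace.hasSum_norm_sq x).summable.mul_left _))⟩
  map_add' x y := DilSpace.ext fun n => map_add (A n) (x n : K) (y n : K)
  map_smul' c x := DilSpace.ext fun n => map_smul (A n) c (x n : K)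

theorem norm_diagLinear_le (x : DilSpace S) : ‖diagLinear A hA hC x‖ ≤ C * ‖x‖ := by
  have hC0 : 0 ≤ C := (norm_nonneg _).trans (hC 0)
  refine le_of_sq_le_sq ?_ (mul_nonneg hC0 (norm_nonneg x))
  rw [mul_pow]
  exact hasSum_le (norm_sq_diag_le A hC x) (DilSpace.hasSum_norm_sq (diagLinear A hA hC x))
    ((DilSpace.hasSum_norm_sq x).mul_left _)

/-- The componentwise action of a bounded sequence of operators that preserve the summands. -/
noncomputable def diagOp : DilSpace S →L[ℂ] DilSpace S :=
  (diagLinear A hA hC).mkContinuous C (norm_diagLinear_le A hA hC)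

end Diagonal

/-- The components of the image of a vector under the minimal unitary dilation. -/
noncomputable def dilShift (S : K →ₗᵢ[ℂ] K) (x : ∀ n, dilSummand S n) : ∀ n, dilSummand S n
  | 0 => ⟨S (x 0) + x 1, trivial⟩
  | n + 1 => ⟨x (n + 2), (x (n + 2)).2⟩

/-- Pythagoras: x₁ lies in the defect space, orthogonal to the range of S. -/
theorem norm_sq_dilShift_zero (x : ∀ n, dilSummand S n) :
    ‖(dilShift S x 0 : K)‖ ^ 2 = ‖(x 0 : K)‖ ^ 2 + ‖(x 1 : K)‖ ^ 2 := by
  have h1 : inner ℂ (S (x 0)) (x 1 : K) = 0 := (x 1).2 _ ⟨_, rfl⟩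
  have h2 := norm_add_sq_eq_norm_sq_add_norm_sq_of_inner_eq_zero _ _ h1
  rw [S.norm_map] at h2
  rw [sq, sq, sq]
  exact h2

theorem hasSum_norm_sq_dilShift (x : DilSpace S) :
    HasSum (fun n => ‖(dilShift S x n : K)‖ ^ 2) (‖x‖ ^ 2) := by
  -- Two leading terms of x merge into the single leading term of its image; the tails agree.
  have h1 := (hasSum_nat_add_iff' 2).2 (DilSpace.hasSum_norm_sq x)
  refine (hasSum_nat_add_iff' 1).1 ?_
  simp only [Finset.sum_range_succ, Finset.sum_range_zero, zero_add] at h1 ⊢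
  rw [norm_sq_dilShift_zero]
  exact h1

/-- The minimal unitary dilation of an isometry, as an isometry. -/
noncomputable def dilIsometry (S : K →ₗᵢ[ℂ] K) : DilSpace S →ₗᵢ[ℂ] DilSpace S where
  toFun x := ⟨dilShift S x, memℓp_dilSummand (hasSum_norm_sq_dilShift x).summable⟩
  map_add' x y := by
    refine DilSpace.ext fun n => ?_
    rcases n with _ | n
    · change S ((x 0 : K) + y 0) + ((x 1 : K) + y 1) = (S (x 0) + x 1) + (S (y 0) + y 1)
      rw [map_add]
      abel
    · rfl
  map_smul' c x := by
    refine DilSpace.ext fun n => ?_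
    rcases n with _ | n
    · change S (c • (x 0 : K)) + c • (x 1 : K) = c • (S (x 0) + x 1)
      rw [map_smul, smul_add]
    · rfl
  norm_map' x := by
    refine (sq_eq_sq₀ (norm_nonneg _) (norm_nonneg _)).1 ?_
    exact (DilSpace.hasSum_norm_sq _).unique (hasSum_norm_sq_dilShift x)

theorem dilIsometry_apply_zero (x : DilSpace S) : (dilIsometry S x 0 : K) = S (x 0) + x 1 := rfl

theorem dilIsometry_apply_succ (x : DilSpace S) (n : ℕ) :
    (dilIsometry S x (n + 1) : K) = x (n + 2) := rfl

/-- The inclusion of the original space into the space of the dilation. -/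
noncomputable def dilBase (k : K) : DilSpace S := lp.single 2 0 ⟨k, trivial⟩

/-- The inclusion of the copies of the defect space into the space of the dilation. -/
noncomputable def dilTail (n : ℕ) (l : defect S) : DilSpace S := lp.single 2 (n + 1) l

theorem dilBase_zero (k : K) : (dilBase (S := S) k 0 : K) = k := by
  rw [dilBase, lp.single_apply_self]

theorem dilBase_succ (k : K) (n : ℕ) : (dilBase (S := S) k (n + 1) : K) = 0 := by
  rw [dilBase, lp.single_apply_ne _ _ _ (by omega)]; rfl

theorem dilTail_self (n : ℕ) (l : defect S) : (dilTail n l (n + 1) : K) = l := by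
  exact congrArg Subtype.val (lp.single_apply_self (E := fun n => dilSummand S n) 2 (n + 1) l)

theorem dilTail_ne {n m : ℕ} (l : defect S) (h : m ≠ n + 1) : (dilTail n l m : K) = 0 := by
  exact congrArg Subtype.val (lp.single_apply_ne (E := fun n => dilSummand S n) 2 (n + 1) l h)

theorem dilIsometry_dilBase (k : K) : dilIsometry S (dilBase k) = dilBase (S k) := by
  refine DilSpace.ext fun n => ?_
  rcases n with _ | n
  · rw [dilIsometry_apply_zero, dilBase_zero, dilBase_zero, dilBase_succ, add_zero]
  · rw [dilIsometry_apply_succ, dilBase_succ, dilBase_succ]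

theorem dilIsometry_dilTail_zero (l : defect S) :
    dilIsometry S (dilTail 0 l) = dilBase (l : K) := by
  refine DilSpace.ext fun n => ?_
  rcases n with _ | n
  · rw [dilIsometry_apply_zero, dilBase_zero, dilTail_ne l (by omega), dilTail_self, map_zero,
      zero_add]
  · rw [dilIsometry_apply_succ, dilBase_succ, dilTail_ne l (by omega)]

theorem dilIsometry_dilTail_succ (n : ℕ) (l : defect S) :
    dilIsometry S (dilTail (n + 1) l) = dilTail n l := by
  refine DilSpace.ext fun m => ?_
  rcases m with _ | m
  · rw [dilIsometry_apply_zero, dilTail_ne l (by omega), dilTail_ne l (by omega),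
      dilTail_ne l (by omega), map_zero, zero_add]
  · rw [dilIsometry_apply_succ]
    by_cases hm : m = n
    · subst hm
      rw [dilTail_self, dilTail_self]
    · rw [dilTail_ne l (by omega), dilTail_ne l (by omega)]

theorem eq_top_of_dilBase_mem_of_dilTail_mem (W : Submodule ℂ (DilSpace S))
    (hW : IsClosed (W : Set (DilSpace S))) (hbase : ∀ k, dilBase k ∈ W)
    (htail : ∀ n l, dilTail n l ∈ W) : W = ⊤ := by
  rw [eq_top_iff]
  intro x _
  refine hW.mem_of_tendsto (lp.hasSum_single (by norm_num) x)
    (Filter.Eventually.of_forall fun s => W.sum_mem fun n _ => ?_)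
  rcases n with _ | n
  · exact hbase (x 0)
  · exact htail n (x (n + 1))

/-- A closed subspace that contains the original space and is invariant under the inverse of the
dilation is the whole space of the dilation. -/
theorem eq_top_of_dilIsometry_comap_le (W : Submodule ℂ (DilSpace S))
    (hW : IsClosed (W : Set (DilSpace S))) (hbase : ∀ k, dilBase k ∈ W)
    (hinv : ∀ x, dilIsometry S x ∈ W → x ∈ W) : W = ⊤ := by
  refine eq_top_of_dilBase_mem_of_dilTail_mem W hW hbase fun n => ?_
  induction n with
  | zero => exact fun l => hinv _ (by rw [dilIsometry_dilTail_zero]; exact hbase _)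
  | succ n ih => exact fun l => hinv _ (by rw [dilIsometry_dilTail_succ]; exact ih l)

/-- The range is closed. It contains each tail vector, as the image of the next one, and each base
vector k, after splitting k = Sa + l with l in the defect space. -/
theorem dilIsometry_surjective [CompleteSpace K] (S : K →ₗᵢ[ℂ] K) :
    Function.Surjective (dilIsometry S) := by
  have hclosed : IsClosed ((LinearMap.range (dilIsometry S).toLinearMap :
      Submodule ℂ (DilSpace S)) : Set (DilSpace S)) :=
    (dilIsometry S).isometry.isClosedEmbedding.isClosed_range
  have hSclosed : IsClosed ((LinearMap.range S.toLinearMap : Submodule ℂ K) : Set K) :=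
    S.isometry.isClosedEmbedding.isClosed_range
  have : CompleteSpace (LinearMap.range S.toLinearMap) := hSclosed.completeSpace_coe
  refine LinearMap.range_eq_top (f := (dilIsometry S).toLinearMap).1 ?_
  have hbase : ∀ k, dilBase k ∈ LinearMap.range (dilIsometry S).toLinearMap := by
    intro k
    obtain ⟨⟨_, a, rfl⟩, hy⟩ : ∃ y : LinearMap.range S.toLinearMap, k - y ∈ defect S :=
      ⟨⟨_, (LinearMap.range S.toLinearMap).starProjection_apply_mem k⟩,
        sub_starProjection_mem_orthogonal k⟩
    refine ⟨dilBase a + dilTail 0 ⟨_, hy⟩, ?_⟩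
    rw [map_add]
    change dilIsometry S _ + dilIsometry S _ = _
    rw [dilIsometry_dilBase, dilIsometry_dilTail_zero]
    refine DilSpace.ext fun n => ?_
    rcases n with _ | n
    · change ((dilBase _ : DilSpace S) 0 : K) + ((dilBase _ : DilSpace S) 0 : K) = _
      simp only [dilBase_zero]
      exact add_sub_cancel _ _
    · change ((dilBase _ : DilSpace S) (n + 1) : K) + ((dilBase _ : DilSpace S) (n + 1) : K) = _
      simp only [dilBase_succ, add_zero]
  exact eq_top_of_dilBase_mem_of_dilTail_mem _ hclosed hbase fun n l =>
    ⟨dilTail (n + 1) l, dilIsometry_dilTail_succ n l⟩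

end Dilation
-- The representation of L^∞ on the dilation space
/-- The `n`-th iterate of `f ↦ f(z ^ N)`. -/
noncomputable def LInf.dilateIter (N : ℕ) [NeZero N] : ℕ → LInf →⋆ₐ[ℂ] LInf
  | 0 => StarAlgHom.id ℂ LInf
  | n + 1 => (LInf.dilateIter N n).comp
    { toFun := LInf.dilate N
      map_one' := rfl
      map_mul' := fun _ _ => rfl
      map_zero' := rfl
      map_add' := fun _ _ => rfl
      commutes' := fun _ => rfl
      map_star' := fun _ => rfl }

theorem LInf.dilateIter_succ (N : ℕ) [NeZero N] (n : ℕ) (f : LInf) :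
    LInf.dilateIter N (n + 1) f = LInf.dilateIter N n (LInf.dilate N f) := rfl

theorem LInf.dilateIter_succ' (N : ℕ) [NeZero N] (n : ℕ) (f : LInf) :
    LInf.dilateIter N (n + 1) f = LInf.dilate N (LInf.dilateIter N n f) := by
  induction n generalizing f with
  | zero => rfl
  | succ n ih => rw [LInf.dilateIter_succ, ih, ← LInf.dilateIter_succ]

theorem LInf.supNorm_dilateIter (N : ℕ) [NeZero N] (n : ℕ) (f : LInf) :
    LInf.supNorm (LInf.dilateIter N n f) = LInf.supNorm f := by
  induction n with
  | zero => rfl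
  | succ n ih => rw [LInf.dilateIter_succ', LInf.supNorm_dilate, ih]

theorem LInf.dilate_ae_eq {N : ℕ} [NeZero N] {f g : LInf}
    (hfg : (f : Circle → ℂ) =ᵐ[haar] (g : Circle → ℂ)) :
    (LInf.dilate N f : Circle → ℂ) =ᵐ[haar] (LInf.dilate N g : Circle → ℂ) :=
  (measurePreserving_pow (NeZero.ne N)).quasiMeasurePreserving.ae_eq_comp hfg

theorem LInf.dilateIter_ae_eq {N : ℕ} [NeZero N] {f g : LInf}
    (hfg : (f : Circle → ℂ) =ᵐ[haar] (g : Circle → ℂ)) (n : ℕ) :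
    (LInf.dilateIter N n f : Circle → ℂ) =ᵐ[haar] (LInf.dilateIter N n g : Circle → ℂ) := by
  induction n with
  | zero => exact hfg
  | succ n ih =>
    rw [LInf.dilateIter_succ', LInf.dilateIter_succ']
    exact LInf.dilate_ae_eq ih

section DilationRep

variable {K : Type} [NormedAddCommGroup K] [InnerProductSpace ℂ K] [CompleteSpace K]
  {S : K →ₗᵢ[ℂ] K} {N : ℕ} [NeZero N] {π₀ : LInf →⋆ₐ[ℂ] (K →L[ℂ] K)}
  (hS : ∀ f k, S (π₀ f k) = π₀ (LInf.dilate N f) (S k))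
  (hbound : ∀ f, ‖π₀ f‖ ≤ LInf.supNorm f)
  (hcongr : ∀ f g : LInf, (f : Circle → ℂ) =ᵐ[haar] (g : Circle → ℂ) → π₀ f = π₀ g)

-- By covariance the range of S is stable under π₀(f(z^N)) and its adjoint, hence so is the defect
-- space. This uses the outermost dilation, available at every index n + 1.
include hS in
theorem dilateIter_mapsTo_dilSummand (f : LInf) :
    ∀ n, ∀ x ∈ dilSummand S n, π₀ (LInf.dilateIter N n f) x ∈ dilSummand S n
  | 0, _, _ => trivial
  | n + 1, x, hx => by
    rintro _ ⟨a, rfl⟩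
    rw [LInf.dilateIter_succ', ← inner_star_apply, ← map_star]
    change inner ℂ (π₀ (LInf.dilate N (star (LInf.dilateIter N n f))) (S a)) x = 0
    rw [← hS]
    exact hx _ ⟨_, rfl⟩

include hbound in
theorem norm_dilateIter_le (f : LInf) (n : ℕ) :
    ‖π₀ (LInf.dilateIter N n f)‖ ≤ LInf.supNorm f :=
  (hbound _).trans (LInf.supNorm_dilateIter N n f).le

/-- The action of `f ∈ L^∞(𝕋)` on the space of the dilation. -/
noncomputable def dilAct (f : LInf) : DilSpace S →L[ℂ] DilSpace S :=
  diagOp (fun n => π₀ (LInf.dilateIter N n f)) (dilateIter_mapsTo_dilSummand hS f)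
    (norm_dilateIter_le hbound f)

theorem coe_dilAct_apply (f : LInf) (x : DilSpace S) (n : ℕ) :
    (dilAct hS hbound f x n : K) = π₀ (LInf.dilateIter N n f) (x n) := rfl

omit [CompleteSpace K] in
theorem dilAct_ext {A B : DilSpace S →L[ℂ] DilSpace S}
    (h : ∀ x n, (A x n : K) = B x n) : A = B :=
  ContinuousLinearMap.ext fun x => DilSpace.ext fun n => h x n

/-- The representation of `L^∞(𝕋)` on the space of the dilation. -/
noncomputable def dilActHom : LInf →⋆ₐ[ℂ] (DilSpace S →L[ℂ] DilSpace S) where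
  toFun := dilAct hS hbound
  map_one' := dilAct_ext fun x n => by
    rw [coe_dilAct_apply, map_one, map_one]; rfl
  map_mul' f g := dilAct_ext fun x n => by
    rw [coe_dilAct_apply, map_mul, map_mul]; rfl
  map_zero' := dilAct_ext fun x n => by
    rw [coe_dilAct_apply, map_zero, map_zero]; rfl
  map_add' f g := dilAct_ext fun x n => by
    rw [coe_dilAct_apply, map_add, map_add]; rfl
  commutes' c := dilAct_ext fun x n => by
    rw [coe_dilAct_apply, AlgHomClass.commutes, AlgHomClass.commutes]; rfl
  map_star' f := by
    refine (ContinuousLinearMap.eq_adjoint_iff _ _).2 fun x y => ?_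
    refine (lp.hasSum_inner (dilAct hS hbound (star f) x) y).unique ?_
    refine (lp.hasSum_inner x (dilAct hS hbound f y)).congr_fun fun n => ?_
    rw [Submodule.coe_inner, Submodule.coe_inner, coe_dilAct_apply, coe_dilAct_apply, map_star,
      map_star, inner_star_apply]

/-- The representation on the space of the minimal unitary dilation of `S`. -/
noncomputable def dilRep : Rep N (DilSpace S) where
  U := (Unitary.linearIsometryEquiv.symm
    (LinearIsometryEquiv.ofSurjective (dilIsometry S) (dilIsometry_surjective S))).1
  U_mem := Subtype.property _
  π := dilActHom hS hbound
  π_congr f g hfg := dilAct_ext fun x n => by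
    change π₀ (LInf.dilateIter N n f) (x n) = π₀ (LInf.dilateIter N n g) (x n)
    rw [hcongr _ _ (LInf.dilateIter_ae_eq hfg n)]
  -- Only component 0 needs the relation for S; elsewhere both sides are f(z^(N^(n+2))) acting on
  -- xₙ₊₂.
  covariant f := dilAct_ext fun x n => by
    rcases n with _ | n
    · change S (π₀ f (x 0)) + π₀ (LInf.dilate N f) (x 1) =
        π₀ (LInf.dilate N f) (S (x 0) + x 1)
      rw [map_add, hS]
    · rfl

theorem dilRep_π_dilBase (f : LInf) (k : K) :
    (dilRep hS hbound hcongr).π f (dilBase k) = dilBase (π₀ f k) := by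
  refine DilSpace.ext fun n => ?_
  change π₀ (LInf.dilateIter N n f) (dilBase k n : K) = _
  rcases n with _ | n
  · rw [dilBase_zero, dilBase_zero]; rfl
  · rw [dilBase_succ, dilBase_succ, map_zero]

omit [CompleteSpace K] in
theorem inner_dilBase (k k' : K) :
    inner ℂ (dilBase k : DilSpace S) (dilBase k') = inner ℂ k k' := by
  rw [dilBase, lp.inner_single_left, Submodule.coe_inner]
  rw [dilBase_zero]

omit [CompleteSpace K] in
theorem continuous_dilBase : Continuous (dilBase : K → DilSpace S) := by
  refine (lp.isometry_single (E := fun n => dilSummand S n) (p := 2) 0).continuous.comp ?_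
  exact Continuous.subtype_mk continuous_id _

end DilationRep

/-! ### Cyclicity and existence -/

namespace Rep

universe u
variable {N : ℕ} [NeZero N] {H : Type u} [NormedAddCommGroup H] [InnerProductSpace ℂ H]
  [CompleteSpace H]

/-- The closure of the orbit of a vector under the represented algebra. -/
noncomputable def orbitClosure (ρ : Rep N H) (φ : H) : Submodule ℂ H :=
  ((Subalgebra.toSubmodule ρ.image.toSubalgebra).map
    (ContinuousLinearMap.apply ℂ H φ : (H →L[ℂ] H) →ₗ[ℂ] H)).topologicalClosure

theorem coe_orbitClosure (ρ : Rep N H) (φ : H) :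
    (ρ.orbitClosure φ : Set H) = closure {x | ∃ A ∈ ρ.image, A φ = x} := rfl

theorem mapsTo_orbitClosure (ρ : Rep N H) {φ : H} {A : H →L[ℂ] H} (hA : A ∈ ρ.image) {x : H}
    (hx : x ∈ ρ.orbitClosure φ) : A x ∈ ρ.orbitClosure φ := by
  rw [← SetLike.mem_coe, coe_orbitClosure] at hx ⊢
  refine Set.MapsTo.closure (f := A) ?_ A.continuous hx
  rintro _ ⟨B, hB, rfl⟩
  exact ⟨A * B, mul_mem hA hB, rfl⟩

theorem adjoin_le_image (ρ : Rep N H) :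
    StarAlgebra.adjoin ℂ ({ρ.U, ρ.V} : Set (H →L[ℂ] H)) ≤ ρ.image :=
  StarSubalgebra.le_topologicalClosure _

end Rep

section Existence

variable {h : Circle → ℝ} (h_int : Integrable h haar)

/-- A bounded function, as a vector of `L²(h dμ)`. -/
noncomputable def LInf.toL2 (f : LInf) : Lp ℂ 2 (weighted h) := (memLp_weighted h_int f 2).toLp

theorem mulOp_toL2_one (f : LInf) : mulOp h_int f (LInf.toL2 h_int 1) = LInf.toL2 h_int f := by
  refine Lp.ext ?_
  filter_upwards [coeFn_mulOp h_int f (LInf.toL2 h_int 1),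
    (memLp_weighted h_int f 2).coeFn_toLp, (memLp_weighted h_int 1 2).coeFn_toLp] with z h1 h2 h3
  rw [h1, LInf.toL2, LInf.toL2, h2, h3]
  exact mul_one _

theorem inner_toL2_one (h_nonneg : ∀ᵐ z ∂haar, 0 ≤ h z) (f : LInf) :
    inner ℂ (LInf.toL2 h_int 1) (LInf.toL2 h_int f) =
      ∫ z, (f : Circle → ℂ) z * (h z : ℂ) ∂haar := by
  have h4 : ∫ z, (f : Circle → ℂ) z ∂(weighted h) =
      ∫ z, (f : Circle → ℂ) z * (h z : ℂ) ∂haar := by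
    rw [integral_weighted h_int h_nonneg]
    refine integral_congr_ae (Filter.Eventually.of_forall fun z => ?_)
    simp [mul_comm]
  rw [L2.inner_def, ← h4]
  refine integral_congr_ae ?_
  filter_upwards [(memLp_weighted h_int f 2).coeFn_toLp,
    (memLp_weighted h_int 1 2).coeFn_toLp] with z h2 h3
  rw [LInf.toL2, LInf.toL2, h2, h3]
  change inner ℂ (1 : ℂ) _ = _
  simp

theorem denseRange_toL2 : DenseRange (LInf.toL2 h_int) := by
  have := isFiniteMeasure_weighted h_int
  refine (ContinuousMap.toLp_denseRange ℂ (weighted h) ℂ (p := 2) (by norm_num)).mono ?_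
  rintro _ ⟨g, rfl⟩
  refine ⟨LInf.ofContinuous g, Lp.ext ?_⟩
  filter_upwards [(memLp_weighted h_int (LInf.ofContinuous g) 2).coeFn_toLp,
    ContinuousMap.coeFn_toLp (p := 2) (𝕜 := ℂ) (weighted h) g] with z h1 h2
  rw [LInf.toL2, h1, h2]
  rfl

theorem filterIsometry_toL2_one {N : ℕ} [NeZero N] {m₀ : LInf}
    (hm₀ : ∀ᵐ z ∂haar, (m₀ : Circle → ℂ) z ≠ 0) (h_nonneg : ∀ᵐ z ∂haar, 0 ≤ h z)
    (h_fix : ruelle N m₀ m₀ (fun z => (h z : ℂ)) =ᵐ[haar] fun z => (h z : ℂ)) :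
    filterIsometry h_int hm₀ h_nonneg h_fix (LInf.toL2 h_int 1) = LInf.toL2 h_int m₀ := by
  refine Lp.ext ?_
  filter_upwards [coeFn_filterIsometry h_int hm₀ h_nonneg h_fix (LInf.toL2 h_int 1),
    (memLp_weighted h_int m₀ 2).coeFn_toLp,
    (quasiMeasurePreserving_pow_weighted hm₀ h_int h_nonneg h_fix).ae_eq_comp
      (memLp_weighted h_int 1 2).coeFn_toLp] with z h1 h2 h3
  simp only [Function.comp_apply] at h3
  rw [h1, LInf.toL2, LInf.toL2, h2, h3]
  exact mul_one _

theorem exists_isAssociated {N : ℕ} [NeZero N] {m₀ : LInf}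
    (hm₀ : ∀ᵐ z ∂haar, (m₀ : Circle → ℂ) z ≠ 0) (h_int : Integrable h haar)
    (h_nonneg : ∀ᵐ z ∂haar, 0 ≤ h z)
    (h_fix : ruelle N m₀ m₀ (fun z => (h z : ℂ)) =ᵐ[haar] fun z => (h z : ℂ)) :
    ∃ (H : Type) (_ : NormedAddCommGroup H) (_ : InnerProductSpace ℂ H) (_ : CompleteSpace H)
      (ρ : Rep N H) (φ : H), ρ.IsAssociated m₀ h φ := by
  let S := filterIsometry h_int hm₀ h_nonneg h_fix
  let ρ : Rep N (DilSpace S) := dilRep (π₀ := mulRep h_int)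
    (filterIsometry_mulOp h_int hm₀ h_nonneg h_fix) (norm_mulOp_le h_int)
    (fun _ _ => mulOp_congr h_int)
  have hπ : ∀ f k, ρ.π f (dilBase k) = dilBase (mulOp h_int f k) := fun f k =>
    dilRep_π_dilBase _ _ _ f k
  have hU : ∀ x, ρ.U x = dilIsometry S x := fun x => rfl
  let φ : DilSpace S := dilBase (LInf.toL2 h_int 1)
  have moment : ∀ f : LInf,
      inner ℂ φ (ρ.π f φ) = ∫ z, (f : Circle → ℂ) z * (h z : ℂ) ∂haar := fun f => by
    rw [hπ, mulOp_toL2_one, inner_dilBase, inner_toL2_one h_int h_nonneg]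
  refine ⟨DilSpace S, inferInstance, inferInstance, inferInstance, ρ, φ, ?_, ?_, moment⟩
  · have hclosed : IsClosed (ρ.orbitClosure φ : Set (DilSpace S)) := isClosed_closure
    have htop : ρ.orbitClosure φ = ⊤ := by
      -- The orbit closure contains the base copy of L²(h dμ), since bounded functions are dense
      -- there, and it is stable under U⁻¹ = U*.
      refine eq_top_of_dilIsometry_comap_le _ hclosed (fun k => ?_) fun x hx => ?_
      · refine (hclosed.preimage continuous_dilBase).closure_subset_iff.2 ?_
          ((denseRange_toL2 h_int) k)
        rintro _ ⟨f, rfl⟩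
        change dilBase _ ∈ closure _
        rw [← mulOp_toL2_one, ← hπ]
        refine closure_mono ?_ (ρ.π_apply_mem_closure h_int h_nonneg moment f)
        rintro _ ⟨A, hA, rfl⟩
        exact ⟨A, ρ.adjoin_le_image (StarAlgebra.adjoin_mono (by simp) hA), rfl⟩
      · rw [← ρ.star_U_U x, hU]
        exact ρ.mapsTo_orbitClosure (star_mem (ρ.adjoin_le_image
          (StarAlgebra.subset_adjoin ℂ _ (by simp)))) hx
    exact dense_iff_closure_eq.2 (congrArg SetLike.coe htop)
  · rw [hπ, mulOp_toL2_one, hU, dilIsometry_dilBase]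
    exact congrArg dilBase (filterIsometry_toL2_one h_int hm₀ h_nonneg h_fix)

end Existence

end WaveletGalerkin

theorem theorem1 (N : ℕ) [NeZero N] (hN : 2 ≤ N)
    (m₀ : WaveletGalerkin.LInf)
    (hm₀ : ∀ᵐ z ∂WaveletGalerkin.haar, (m₀ : Circle → ℂ) z ≠ 0)
    (h : Circle → ℝ) (h_int : MeasureTheory.Integrable h WaveletGalerkin.haar)
    (h_nonneg : ∀ᵐ z ∂WaveletGalerkin.haar, 0 ≤ h z)
    (h_fix : WaveletGalerkin.ruelle N m₀ m₀ (fun z => (h z : ℂ))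
      =ᵐ[WaveletGalerkin.haar] fun z => (h z : ℂ)) :
    (∃ (H : Type) (_ : NormedAddCommGroup H) (_ : InnerProductSpace ℂ H) (_ : CompleteSpace H)
      (ρ : WaveletGalerkin.Rep N H) (φ : H), ρ.IsAssociated m₀ h φ) ∧
    ∀ (H : Type*) [NormedAddCommGroup H] [InnerProductSpace ℂ H] [CompleteSpace H]
      (ρ : WaveletGalerkin.Rep N H) (φ : H), ρ.IsAssociated m₀ h φ →
      ∀ S ∈ ρ.commutant, ∀ T ∈ ρ.commutant, S * T = T * S :=
  ⟨WaveletGalerkin.exists_isAssociated hm₀ h_int h_nonneg h_fix,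
    fun _ _ _ _ _ _ hρ _ hS _ hT => hρ.commutant_comm h_int h_nonneg hS hT⟩
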